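/- Let $n,r\ge 0$ be integers, and let $q$, $z$ and $x_1,\dots,x_n$ be indeterminates (or, more generally, elements of a field such that $q$ and the $x_i$ are nonzero and no denominator below vanishes, where in the series only the terms with $i\le r$ are considered, the later ones being zero). Write $(a;q)_k=\prod_{i=0}^{k-1}(1-aq^i)$ for $k\ge0$, $(a;q)_{-m}=1/(aq^{-m};q)_m$ for $m>0$, and $${}_{s+1}\phi_s\left[\begin{matrix}a_1,\dots,a_{s+1}\\ b_1,\dots,b_s\end{matrix};q,w\right]=\sum_{i\ge0}\frac{(a_1;q)_i\cdots(a_{s+1};q)_i}{(b_1;q)_i\cdots(b_s;q)_i}\,\frac{w^i}{(q;q)_i}.$$ Then $$\sum_{\sigma\in\{-1,+1\}^n}\ \prod_{i=1}^n\frac{1-qx_i^{2\sigma_i}}{1-x_i^{2\sigma_i}}\,\frac{1-q^rzx_i^{-\sigma_i}}{1-zx_i^{-\sigma_i}}\ \prod_{1\le i<j\le n}\frac{1-qx_i^{\sigma_i}x_j^{\sigma_j}}{1-x_i^{\sigma_i}x_j^{\sigma_j}}$$ $$=q^{nr-\binom r2}\,(-q;q)_{n-r}\,\frac{(qz^2;q^2)_r}{(qz^2;q)_r}\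 {}_{2n+4}\phi_{2n+3}\left[\begin{matrix}z^2,\,qz,\,-qz,\,q^{-r},\,\{qzx_i,\,qz/x_i\}_{1\le i\le n}\\ z,\,-z,\,q^{r+1}z^2,\,\{zx_i,\,z/x_i\}_{1\le i\le n}\end{matrix};q,-q^{r-n}\right].$$ The series on the right terminates (its terms with $i>r$ are zero) and is very-well-poised: when each $qzx_i$ is paired with $z/x_i$ and each $qz/x_i$ with $zx_i$, and $qz$, $-qz$, $q^{-r}$ are paired with $z$, $-z$, $q^{r+1}z^2$, the product of every pair equals $q\cdot z^2$, where $z^2$ is the first upper parameter, and the next two upper parameters are $\pm q$ times its square root $z$. -/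

import Mathlib

/-- The `q`-shifted factorial `(a;q)_k = (1 - a)(1 - a q) ⋯ (1 - a q^(k-1))` for a natural
number `k`. -/
def qPoch {K : Type*} [Field K] (a q : K) (k : ℕ) : K :=
  ∏ i ∈ Finset.range k, (1 - a * q ^ i)

/-- The `q`-shifted factorial with an integer index: `(a;q)_k` is the product above for `k ≥ 0`,
and `(a;q)_{-m} = 1 / (a q^{-m};q)_m` for `m > 0`. -/
def qPochInt {K : Type*} [Field K] (a q : K) : ℤ → K
  | Int.ofNat k => qPoch a q k
  | Int.negSucc k => (qPoch (a * q ^ (-((k : ℤ) + 1))) q (k + 1))⁻¹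

/-- The `m`-th term of the series `_{s+1}φ_s` with upper parameters `a`, lower parameters `b`,
base `q` and argument `w`. -/
def qHypTerm {K : Type*} [Field K] {s : ℕ} (a : Fin (s + 1) → K) (b : Fin s → K) (q w : K)
    (m : ℕ) : K :=
  (∏ i, qPoch (a i) q m) / (∏ i, qPoch (b i) q m) * (w ^ m / qPoch q q m)

/-- The basic hypergeometric series `_{s+1}φ_s [a; b; q, w]`. -/
noncomputable def qHyp {K : Type*} [Field K] [TopologicalSpace K] {s : ℕ}
    (a : Fin (s + 1) → K) (b : Fin s → K) (q w : K) : K :=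
  ∑' m : ℕ, qHypTerm a b q w m

/-- `_{s+3}φ_{s+2} [a; b; q, ·]` is very-well-poised: writing `a = (a₁, …, a_{s+3})` and
`b = (b₁, …, b_{s+2})`, one has `q a₁ = a₂ b₁ = a₃ b₂ = ⋯ = a_{s+3} b_{s+2}` and
`a₂ = q c`, `a₃ = -q c` for a square root `c` of `a₁`. -/
def IsVeryWellPoised {K : Type*} [Field K] {s : ℕ} (a : Fin (s + 3) → K) (b : Fin (s + 2) → K)
    (q : K) : Prop :=
  (∀ i : Fin (s + 2), a i.succ * b i = q * a 0) ∧
    ∃ c : K, c ^ 2 = a 0 ∧ a 1 = q * c ∧ a 2 = -(q * c)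

/-- The upper parameters `z², qz, -qz, q^{-r}, {q z x_i}, {q z / x_i}`, which are `2n + 4` in
number. -/
def upperParams {K : Type*} [Field K] {n : ℕ} (r : ℕ) (x : Fin n → K) (z q : K) :
    Fin (n + n + 1 + 3) → K :=
  Matrix.vecCons (z ^ 2) (Matrix.vecCons (q * z) (Matrix.vecCons (-(q * z))
    (Matrix.vecCons (q ^ (-(r : ℤ)))
      (Fin.append (fun i => q * z * x i) (fun i => q * z / x i)))))

/-- The lower parameters `z, -z, q^{r+1} z², {z / x_i}, {z x_i}`, which are `2n + 3` in number
(each is listed at the place of the upper parameter with which it is paired). -/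
def lowerParams {K : Type*} [Field K] {n : ℕ} (r : ℕ) (x : Fin n → K) (z q : K) :
    Fin (n + n + 1 + 2) → K :=
  Matrix.vecCons z (Matrix.vecCons (-z) (Matrix.vecCons (q ^ (r + 1) * z ^ 2)
    (Fin.append (fun i => z / x i) (fun i => z * x i))))

/-- The sum over all sign vectors `σ ∈ {-1, +1}^n` of
`∏_i (1 - q x_i^{2σ_i}) / (1 - x_i^{2σ_i}) * (1 - q^r z x_i^{-σ_i}) / (1 - z x_i^{-σ_i})`
times `∏_{i<j} (1 - q x_i^{σ_i} x_j^{σ_j}) / (1 - x_i^{σ_i} x_j^{σ_j})`. -/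
def signSum {K : Type*} [Field K] {n : ℕ} (r : ℕ) (x : Fin n → K) (z q : K) : K :=
  ∑ σ : Fin n → ℤˣ,
    (∏ i, ((1 - q * x i ^ (2 * (σ i : ℤ))) / (1 - x i ^ (2 * (σ i : ℤ))) *
        ((1 - q ^ r * z * x i ^ (-(σ i : ℤ))) / (1 - z * x i ^ (-(σ i : ℤ)))))) *
      ∏ i, ∏ j ∈ Finset.Ioi i,
        ((1 - q * x i ^ (σ i : ℤ) * x j ^ (σ j : ℤ)) / (1 - x i ^ (σ i : ℤ) * x j ^ (σ j : ℤ)))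

/-! ### Shifted factorials: shift rules and nonvanishing. -/

section QPoch

variable {K : Type*} [Field K]

/-! Multiply the sum over signs by `∏ (1 - z x_i) (1 - z / x_i)`. On the series side the quotients
`(q z x;q)_m / (z x;q)_m` collapse to `(1 - z x q^m) / (1 - z x)`. The claim thus becomes an
expansion of the cleared sum in the products `nodeProd`, with coefficients `poisedCoeff` independent
of the `x_i` (`sum_signTerm_eq`).

The expansion is proved by induction on the number of variables, for all `r` and `z` at once. Regard
one variable as an unknown `t`, pair its two signs, and clear the denominators in `t`. The
difference of the two sides becomes a polynomial of degree at most `2n + 4` (`expansionDefect`),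
where `n` is the number of remaining variables. It vanishes at `2n + 5` distinct points: at `0`, by
the case `n` and the recurrence of the coefficients in `n` (`poisedCoeff_succ_left`); at `±1`, by
the antisymmetry of the numerator under `t ↦ 1/t`; at each `x_j` and `1/x_j`, because the terms with
opposite signs of `x_j` cancel; at `z` and `1/z`, where the sum reduces to the one with `(n, r - 1,
qz)`, matched by `poisedCoeff_succ_succ`.

With no variables, the claim is that the coefficients sum to `1`, shown by telescoping in `r`
(`sum_poisedCoeff_zero`).

The interpolation needs parameters in general position. It is therefore applied to indeterminates
over `ℤ`, and the identity of rational functions is specialized to `K` along fractions whose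
denominators survive (`IsSpecialization`). -/

theorem qPoch_zero (a q : K) : qPoch a q 0 = 1 := by simp [qPoch]

theorem qPoch_succ (a q : K) (k : ℕ) : qPoch a q (k + 1) = qPoch a q k * (1 - a * q ^ k) :=
  Finset.prod_range_succ _ _

theorem qPoch_succ' (a q : K) (k : ℕ) : qPoch a q (k + 1) = (1 - a) * qPoch (a * q) q k := by
  simp only [qPoch, Finset.prod_range_succ']
  rw [mul_comm]
  simp [pow_succ', mul_assoc]

theorem qPoch_shift (a q : K) (k : ℕ) :
    qPoch a q k * (1 - a * q ^ k) = (1 - a) * qPoch (a * q) q k := by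
  rw [← qPoch_succ, qPoch_succ']

theorem qPoch_ne_zero {a q : K} {k : ℕ} (h : ∀ i < k, a * q ^ i ≠ 1) : qPoch a q k ≠ 0 := by
  refine Finset.prod_ne_zero_iff.2 fun i hi => sub_ne_zero.2 (h i (Finset.mem_range.1 hi)).symm

theorem qPoch_ne_zero_of_le {a q : K} {k l : ℕ} (hkl : k ≤ l) (h : qPoch a q l ≠ 0) :
    qPoch a q k ≠ 0 := by
  rw [qPoch, Finset.prod_ne_zero_iff] at h ⊢
  exact fun i hi => h i (Finset.mem_range.2 ((Finset.mem_range.1 hi).trans_le hkl))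

theorem qPoch_zpow_neg_eq_zero {q : K} (hq : q ≠ 0) {r m : ℕ} (h : r < m) :
    qPoch (q ^ (-(r : ℤ))) q m = 0 := by
  refine Finset.prod_eq_zero (Finset.mem_range.2 h) ?_
  rw [← zpow_natCast, ← zpow_add₀ hq]
  simp

theorem qPochInt_add_one {a q : K} (hq : q ≠ 0) (h : ∀ d : ℤ, a * q ^ d ≠ 1) (d : ℤ) :
    qPochInt a q (d + 1) = qPochInt a q d * (1 - a * q ^ d) := by
  rcases d with k | k
  · change qPoch a q (k + 1) = _
    rw [qPoch_succ]
    simp [qPochInt]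
  · have e : ∀ l : ℕ, qPochInt a q (-(l : ℤ)) = (qPoch (a * q ^ (-(l : ℤ))) q l)⁻¹ := by
      intro l
      rcases l with _ | l
      · simp [qPochInt, qPoch]
      · have h0 : -((l + 1 : ℕ) : ℤ) = Int.negSucc l := rfl
        rw [h0, qPochInt, Int.negSucc_eq]
    have h1 : Int.negSucc k = -((k + 1 : ℕ) : ℤ) := rfl
    have h2 : Int.negSucc k + 1 = -(k : ℤ) := by rw [h1]; push_cast; ring
    have h3 : a * q ^ (-((k + 1 : ℕ) : ℤ)) * q = a * q ^ (-(k : ℤ)) := by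
      rw [mul_assoc, ← zpow_add_one₀ hq]; congr 2
    rw [h2, h1, e, e, qPoch_succ', h3, mul_inv, mul_right_comm, inv_mul_cancel₀, one_mul]
    exact sub_ne_zero.2 (h _).symm

end QPoch

/-! ### The expansion coefficients and their recurrences in `n` and in `(n, r, z)`. -/

section Coefficients

variable {K : Type*} [Field K]

/-- The part of the coefficient that depends on the summation index, without the factor
`(1 - a q^{2m}) / (1 - a)` and the argument of the series. -/
noncomputable def poisedQuot (a q : K) (r m : ℕ) : K :=
  qPoch a q m * qPoch (q ^ (-(r : ℤ))) q m / (qPoch (q ^ (r + 1) * a) q m * qPoch q q m)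

/-- The prefactor of the series. -/
noncomputable def prefactor (z q : K) (n r : ℕ) : K :=
  q ^ ((n : ℤ) * (r : ℤ) - (r.choose 2 : ℤ)) * qPochInt (-q) q ((n : ℤ) - (r : ℤ)) *
    (qPoch (q * z ^ 2) (q ^ 2) r / qPoch (q * z ^ 2) q r)

/-- The coefficient of `∏ (1 - z q^m x_i) (1 - z q^m / x_i)` in the expansion of the sum over
signs multiplied by `∏ (1 - z x_i) (1 - z / x_i)`. -/
noncomputable def poisedCoeff (z q : K) (n r m : ℕ) : K :=
  prefactor z q n r * ((1 - z ^ 2 * q ^ (2 * m)) / (1 - z ^ 2) * poisedQuot (z ^ 2) q r m *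
    (-q ^ ((r : ℤ) - (n : ℤ))) ^ m)

/-- This is the comparison of the two sides at `t = 0`: there the paired numerator equals `-z (q^r +
q^(n+1))` and the `m`-th node factor equals `-z q^m`. -/
theorem poisedCoeff_succ_left {z q : K} (hq : q ≠ 0) (hneg : ∀ d : ℤ, 1 + q ^ d ≠ 0)
    (n r m : ℕ) :
    q ^ m * poisedCoeff z q (n + 1) r m = (q ^ r + q ^ (n + 1)) * poisedCoeff z q n r m := by
  have h1 : qPochInt (-q) q (((n + 1 : ℕ) : ℤ) - r) =
      qPochInt (-q) q ((n : ℤ) - r) * (1 + q ^ ((n : ℤ) - r + 1)) := by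
    have := qPochInt_add_one (a := -q) hq (fun d h => hneg (d + 1) (by
      rw [zpow_add_one₀ hq]; linear_combination (-h))) ((n : ℤ) - r)
    rw [zpow_add_one₀ hq]
    rw [show (((n + 1 : ℕ) : ℤ) - r) = (n : ℤ) - r + 1 by push_cast; ring, this]
    ring
  have h2 : q ^ (((n + 1 : ℕ) : ℤ) * (r : ℤ) - (r.choose 2 : ℤ)) =
      q ^ ((n : ℤ) * (r : ℤ) - (r.choose 2 : ℤ)) * q ^ r := by
    rw [← zpow_natCast q r, ← zpow_add₀ hq]; congr 1; push_cast; ring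
  have h3 : q ^ m * (-q ^ ((r : ℤ) - ((n + 1 : ℕ) : ℤ))) ^ m = (-q ^ ((r : ℤ) - (n : ℤ))) ^ m := by
    rw [← mul_pow]; congr 1
    rw [show (r : ℤ) - n = (r - ((n + 1 : ℕ) : ℤ)) + 1 by push_cast; ring, zpow_add_one₀ hq]; ring
  have h4 : q ^ r * (1 + q ^ ((n : ℤ) - r + 1)) = q ^ r + q ^ (n + 1) := by
    rw [mul_add, ← zpow_natCast q r, ← zpow_add₀ hq, ← zpow_natCast q (n + 1)]
    congr 2
    · ring
    · push_cast; ring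
  rw [poisedCoeff, poisedCoeff, prefactor, prefactor, h1, h2, ← h3, ← h4]
  ring

/-- This is the comparison at `t = z`. The factors on the left are the node factor `(1 - z q^(m+1)
t) (1 - z q^(m+1) / t)` at `t = z`; those on the right come from `halfSum_self`. Each shifted
factorial loses its first factor or two, which replaces `z` by `q z`. -/
theorem poisedCoeff_succ_succ {z q : K} (hq : q ≠ 0) (hroot : ∀ k : ℕ, q ^ (k + 1) ≠ 1)
    (hz : ∀ k : ℕ, z ^ 2 * q ^ k ≠ 1) (n r m : ℕ) :
    poisedCoeff z q (n + 1) (r + 1) (m + 1) * ((1 - z ^ 2 * q ^ (m + 1)) * (1 - q ^ (m + 1))) =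
      (1 - q * z ^ 2) * (1 - q ^ (r + 1)) * poisedCoeff (q * z) q n r m := by
  have hz' : ∀ k : ℕ, 1 - z ^ 2 * q ^ k ≠ 0 := fun k => sub_ne_zero.2 (hz k).symm
  have hr' : ∀ k : ℕ, 1 - q ^ (k + 1) ≠ 0 := fun k => sub_ne_zero.2 (hroot k).symm
  have hz0 : 1 - z ^ 2 ≠ 0 := by simpa using hz' 0
  have hz1 : 1 - z ^ 2 * q ≠ 0 := by simpa using hz' 1
  have a1 : qPoch (z ^ 2) q (m + 1) * (1 - z ^ 2 * q ^ (m + 1)) =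
      (1 - z ^ 2) * (1 - z ^ 2 * q) * qPoch ((q * z) ^ 2) q m := by
    rw [qPoch_shift, qPoch_succ', show z ^ 2 * q * q = (q * z) ^ 2 by ring]; ring
  have a2 : qPoch (q ^ (-((r + 1 : ℕ) : ℤ))) q (m + 1) =
      (1 - (q ^ (r + 1))⁻¹) * qPoch (q ^ (-(r : ℤ))) q m := by
    rw [qPoch_succ', ← zpow_add_one₀ hq, zpow_neg, zpow_natCast]
    congr 3; push_cast; ring
  have a3 : qPoch (q ^ (r + 1 + 1) * z ^ 2) q (m + 1) =
      (1 - z ^ 2 * q ^ (r + 2)) * qPoch (q ^ (r + 1) * (q * z) ^ 2) q m := by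
    rw [qPoch_succ']; congr 2 <;> ring
  have a4 : qPoch q q (m + 1) = qPoch q q m * (1 - q ^ (m + 1)) := by rw [qPoch_succ, pow_succ']
  have a5 : qPoch (q * z ^ 2) (q ^ 2) (r + 1) =
      (1 - z ^ 2 * q) * qPoch (q * (q * z) ^ 2) (q ^ 2) r := by
    rw [qPoch_succ']; congr 2 <;> ring
  have a6 : qPoch (q * z ^ 2) q (r + 1) * (1 - z ^ 2 * q ^ (r + 2)) =
      (1 - z ^ 2 * q) * (1 - z ^ 2 * q ^ 2) * qPoch (q * (q * z) ^ 2) q r := by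
    have := qPoch_shift (q * z ^ 2) q (r + 1)
    rw [qPoch_succ' (q * z ^ 2 * q), show q * z ^ 2 * q * q = q * (q * z) ^ 2 by ring] at this
    linear_combination this
  have n1 : qPoch (q * z ^ 2) q (r + 1) ≠ 0 := qPoch_ne_zero fun i _ h => hz (i + 1) (by
    rw [← h]; ring)
  have n2 : qPoch (q * (q * z) ^ 2) q r ≠ 0 := qPoch_ne_zero fun i _ h => hz (i + 3) (by
    rw [← h]; ring)
  have n3 : qPoch q q m ≠ 0 := qPoch_ne_zero fun i _ h => hroot i (by rw [← h]; ring)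
  have n4 : qPoch (q ^ (r + 1) * (q * z) ^ 2) q m ≠ 0 := qPoch_ne_zero fun i _ h =>
    hz (i + r + 3) (by rw [← h]; ring)
  have e1 : q ^ (((n + 1 : ℕ) : ℤ) * ((r + 1 : ℕ) : ℤ) - ((r + 1).choose 2 : ℤ)) =
      q ^ ((n : ℤ) * (r : ℤ) - (r.choose 2 : ℤ)) * q ^ (n + 1) := by
    rw [← zpow_natCast q (n + 1), ← zpow_add₀ hq]; congr 1
    rw [show (r + 1).choose 2 = r + r.choose 2 by simp [Nat.choose_succ_succ' r 1]]
    push_cast; ring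
  have e2 : ((n + 1 : ℕ) : ℤ) - ((r + 1 : ℕ) : ℤ) = n - r := by push_cast; ring
  have e3 : ((r + 1 : ℕ) : ℤ) - ((n + 1 : ℕ) : ℤ) = r - n := by push_cast; ring
  have e4 : q ^ (n + 1) * q ^ ((r : ℤ) - n) = q ^ (r + 1) := by
    rw [← zpow_natCast, ← zpow_add₀ hq, ← zpow_natCast]; congr 1; push_cast; ring
  have b1 : qPoch (q * z ^ 2) (q ^ 2) (r + 1) / qPoch (q * z ^ 2) q (r + 1) =
      (1 - z ^ 2 * q ^ (r + 2)) / (1 - z ^ 2 * q ^ 2) *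
        (qPoch (q * (q * z) ^ 2) (q ^ 2) r / qPoch (q * (q * z) ^ 2) q r) := by
    have := hz' 2
    rw [a5]
    generalize qPoch (q * (q * z) ^ 2) (q ^ 2) r = A at *
    generalize qPoch (q * (q * z) ^ 2) q r = B at *
    generalize qPoch (q * z ^ 2) q (r + 1) = D at *
    rw [div_mul_div_comm, div_eq_div_iff n1 (mul_ne_zero this n2)]
    linear_combination (-A) * a6
  have b2 : poisedQuot (z ^ 2) q (r + 1) (m + 1) *
        ((1 - z ^ 2 * q ^ (m + 1)) * (1 - q ^ (m + 1))) =
      (1 - z ^ 2) * (1 - z ^ 2 * q) * (1 - (q ^ (r + 1))⁻¹) / (1 - z ^ 2 * q ^ (r + 2)) *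
        poisedQuot ((q * z) ^ 2) q r m := by
    have := hz' (r + 2)
    have h4 := hr' m
    rw [poisedQuot, poisedQuot, a2, a3, a4]
    generalize qPoch ((q * z) ^ 2) q m = A at *
    generalize qPoch (z ^ 2) q (m + 1) = B at *
    generalize (q ^ (r + 1))⁻¹ = R at *
    generalize qPoch (q ^ (r + 1) * (q * z) ^ 2) q m = D at *
    generalize qPoch q q m = E at *
    generalize qPoch (q ^ (-(r : ℤ))) q m = G at *
    rw [div_mul_eq_mul_div, div_mul_div_comm,
      div_eq_div_iff (by simp only [ne_eq, mul_eq_zero, *, or_self, not_false_eq_true])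
      (by simp only [ne_eq, mul_eq_zero, *, or_self, not_false_eq_true])]
    linear_combination (1 - R) * G * (1 - q ^ (m + 1)) * (1 - z ^ 2 * q ^ (r + 2)) * D * E * a1
  -- The power gained by the prefactor, the first factor of `(q^(-r-1);q)_(m+1)` and the extra copy
  -- of the argument combine into `1 - q^(r+1)`.
  have c1 : q ^ (n + 1) * (1 - (q ^ (r + 1))⁻¹) * (-q ^ ((r : ℤ) - n)) = 1 - q ^ (r + 1) := by
    have : q ^ (r + 1) ≠ 0 := pow_ne_zero _ hq
    rw [mul_right_comm, mul_neg, e4]; field_simp; ring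
  have h2 := hz' 2
  have hr2 := hz' (r + 2)
  rw [poisedCoeff, poisedCoeff, prefactor, prefactor, e1, e2, e3, b1, pow_succ (-q ^ ((r : ℤ) - n)),
    ← c1]
  have d1 : (1 - z ^ 2 * q ^ (2 * (m + 1))) = (1 - (q * z) ^ 2 * q ^ (2 * m)) := by ring
  have d2 : (1 - (q * z) ^ 2) = 1 - z ^ 2 * q ^ 2 := by ring
  rw [d1, d2]
  generalize qPoch (q * (q * z) ^ 2) (q ^ 2) r / qPoch (q * (q * z) ^ 2) q r = U at *
  generalize (-q ^ ((r : ℤ) - n)) = w at *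
  generalize 1 - (q ^ (r + 1))⁻¹ = R at *
  generalize poisedQuot ((q * z) ^ 2) q r m = V at *
  generalize 1 - (q * z) ^ 2 * q ^ (2 * m) = Y at *
  generalize q ^ ((n : ℤ) * (r : ℤ) - (r.choose 2 : ℤ)) = T at *
  generalize qPochInt (-q) q ((n : ℤ) - r) = S at *
  calc _ = T * q ^ (n + 1) * S * ((1 - z ^ 2 * q ^ (r + 2)) / (1 - z ^ 2 * q ^ 2) * U) *
        (Y / (1 - z ^ 2) * (w ^ m * w)) * (poisedQuot (z ^ 2) q (r + 1) (m + 1) *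
        ((1 - z ^ 2 * q ^ (m + 1)) * (1 - q ^ (m + 1)))) := by ring
    _ = _ := by
      rw [b2]
      field_simp

end Coefficients

/-! ### The case of no variables: the coefficients sum to `1`. -/

section Summation

variable {K : Type*} [Field K]

theorem prefactor_zero_succ {z q : K} (hq : q ≠ 0) (hneg : ∀ d : ℤ, 1 + q ^ d ≠ 0)
    (hz : ∀ k : ℕ, z ^ 2 * q ^ k ≠ 1) (r : ℕ) :
    prefactor z q 0 (r + 1) = prefactor z q 0 r *
      ((1 - z ^ 2 * q * (q ^ r) ^ 2) / ((1 + q ^ r) * (1 - q * q ^ r * z ^ 2))) := by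
  have h1 : qPochInt (-q) q (-(r : ℤ)) =
      qPochInt (-q) q (-((r + 1 : ℕ) : ℤ)) * (1 + (q ^ r)⁻¹) := by
    have := qPochInt_add_one (a := -q) hq (fun d h => hneg (d + 1) (by
      rw [zpow_add_one₀ hq]; linear_combination (-h))) (-((r + 1 : ℕ) : ℤ))
    rw [show -((r + 1 : ℕ) : ℤ) + 1 = -(r : ℤ) by push_cast; ring] at this
    rw [this, ← zpow_natCast, ← zpow_neg,
      show -(r : ℤ) = -((r + 1 : ℕ) : ℤ) + 1 by push_cast; ring, zpow_add_one₀ hq]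
    ring
  have h2 : q ^ (-(r.choose 2 : ℤ)) = q ^ (-((r + 1).choose 2 : ℤ)) * q ^ r := by
    rw [← zpow_natCast q r, ← zpow_add₀ hq]; congr 1
    rw [show (r + 1).choose 2 = r + r.choose 2 by simp [Nat.choose_succ_succ' r 1]]
    push_cast; ring
  have n0 : q ^ r ≠ 0 := pow_ne_zero _ hq
  have n1 : 1 + q ^ r ≠ 0 := by simpa using hneg r
  have n2 : 1 - q * q ^ r * z ^ 2 ≠ 0 :=
    sub_ne_zero.2 fun h => hz (r + 1) (by rw [h]; ring)
  simp only [prefactor, Nat.cast_zero, zero_mul, zero_sub]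
  rw [h1, h2, qPoch_succ, qPoch_succ]
  rw [show 1 - q * z ^ 2 * (q ^ 2) ^ r = 1 - z ^ 2 * q * (q ^ r) ^ 2 by ring,
    show 1 - q * z ^ 2 * q ^ r = 1 - q * q ^ r * z ^ 2 by ring]
  generalize qPoch (q * z ^ 2) (q ^ 2) r = A
  generalize qPoch (q * z ^ 2) q r = B
  generalize q ^ r = R at *
  rw [mul_div_mul_comm, show 1 + R⁻¹ = (1 + R) / R by field_simp; ring]
  field_simp

theorem poisedQuot_succ {a q : K} (hq : q ≠ 0) (hroot : ∀ k : ℕ, q ^ (k + 1) ≠ 1)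
    (ha : ∀ k : ℕ, a * q ^ k ≠ 1) (r m : ℕ) :
    poisedQuot a q r (m + 1) * (-q ^ r) ^ (m + 1) =
      poisedQuot a q r m * (-q ^ r) ^ m * ((1 - a * q ^ m) * (q ^ m - q ^ r) /
        ((1 - q * q ^ r * a * q ^ m) * (1 - q * q ^ m))) := by
  have n0 : q ^ r ≠ 0 := pow_ne_zero _ hq
  have n1 : 1 - q ^ (r + 1) * a * q ^ m ≠ 0 :=
    sub_ne_zero.2 fun h => ha (r + 1 + m) (by rw [h]; ring)
  have n2 : 1 - q * q ^ m ≠ 0 := sub_ne_zero.2 fun h => hroot m (by rw [h]; ring)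
  have e : (1 - q ^ (-(r : ℤ)) * q ^ m) * (-q ^ r) = q ^ m - q ^ r := by
    rw [zpow_neg, zpow_natCast]; field_simp; ring
  rw [poisedQuot, poisedQuot, qPoch_succ, qPoch_succ, qPoch_succ, qPoch_succ, ← e,
    ← pow_succ' q r, pow_succ (-q ^ r)]
  simp only [div_eq_mul_inv, mul_inv]
  ring

/-- Together with `poisedQuot_succ` this expresses every term of the telescoping step through the
single quantity with indices `r`, `m`, so that only a rational identity in `q^r`, `q^m`, `z^2` and
`q` remains. -/
theorem poisedQuot_succ_succ {a q : K} (hq : q ≠ 0) (hroot : ∀ k : ℕ, q ^ (k + 1) ≠ 1)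
    (ha : ∀ k : ℕ, a * q ^ k ≠ 1) (r m : ℕ) :
    poisedQuot a q (r + 1) (m + 1) * (-q ^ (r + 1)) ^ (m + 1) =
      poisedQuot a q r m * (-q ^ r) ^ m *
        ((1 - a * q ^ m) * (1 - q * q ^ r) * (1 - q * q ^ r * a) * q ^ m /
          ((1 - q * q ^ r * a * q ^ m) * (1 - q ^ 2 * q ^ r * a * q ^ m) * (1 - q * q ^ m))) := by
  have n0 : q ^ r ≠ 0 := pow_ne_zero _ hq
  have n1 : 1 - q * q ^ r * a * q ^ m ≠ 0 :=
    sub_ne_zero.2 fun h => ha (r + 1 + m) (by rw [h]; ring)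
  have n2 : 1 - q * q ^ m ≠ 0 := sub_ne_zero.2 fun h => hroot m (by rw [h]; ring)
  have n3 : 1 - q ^ 2 * q ^ r * a * q ^ m ≠ 0 :=
    sub_ne_zero.2 fun h => ha (r + 2 + m) (by rw [h]; ring)
  have n4 : qPoch (q ^ (r + 1) * a) q m ≠ 0 := qPoch_ne_zero fun i _ h =>
    ha (i + r + 1) (by rw [← h]; ring)
  have n5 : qPoch (q ^ (r + 1 + 1) * a) q m ≠ 0 := qPoch_ne_zero fun i _ h =>
    ha (i + r + 2) (by rw [← h]; ring)
  have n6 : qPoch q q m ≠ 0 := qPoch_ne_zero fun i _ h => hroot i (by rw [← h]; ring)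
  have e1 : qPoch (q ^ (-((r + 1 : ℕ) : ℤ))) q (m + 1) * (-q ^ (r + 1)) =
      (1 - q * q ^ r) * qPoch (q ^ (-(r : ℤ))) q m := by
    rw [qPoch_succ', ← zpow_add_one₀ hq, show -((r + 1 : ℕ) : ℤ) + 1 = -(r : ℤ) by push_cast; ring,
      zpow_neg, zpow_natCast]
    field_simp
    ring
  have e2 : qPoch (q ^ (r + 1) * a) q m * (1 - q * q ^ r * a * q ^ m) =
      (1 - q * q ^ r * a) * qPoch (q ^ (r + 1 + 1) * a) q m := by
    have := qPoch_shift (q ^ (r + 1) * a) q m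
    rw [show q ^ (r + 1) * a * q = q ^ (r + 1 + 1) * a by ring] at this
    linear_combination this
  have e3 : 1 - q ^ (r + 1 + 1) * a * q ^ m = 1 - q ^ 2 * q ^ r * a * q ^ m := by ring
  have e4 : (-q ^ (r + 1)) ^ (m + 1) = (-q ^ r) ^ m * q ^ m * (-q ^ (r + 1)) := by
    rw [pow_succ, ← mul_pow]; ring
  rw [poisedQuot, poisedQuot, qPoch_succ a, qPoch_succ (q ^ (r + 1 + 1) * a), qPoch_succ q q, e3, e4]
  generalize qPoch (q ^ (r + 1) * a) q m = A at *
  generalize qPoch (q ^ (r + 1 + 1) * a) q m = B at *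
  generalize qPoch q q m = D at *
  generalize qPoch (q ^ (-(r : ℤ))) q m = G at *
  generalize qPoch (q ^ (-((r + 1 : ℕ) : ℤ))) q (m + 1) = H at *
  generalize (-q ^ r) ^ m = w at *
  generalize qPoch a q m = J at *
  rw [div_mul_eq_mul_div, div_mul_eq_mul_div, div_mul_div_comm]
  have n2' : 1 - q ^ m * q ≠ 0 := by rwa [mul_comm]
  rw [div_eq_div_iff (by simp only [ne_eq, mul_eq_zero, *, or_self, not_false_eq_true])
    (by simp only [ne_eq, mul_eq_zero, *, or_self, not_false_eq_true])]
  calc _ = J * (1 - a * q ^ m) * (H * (-q ^ (r + 1))) * w * q ^ m * D * (1 - q * q ^ m) *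
      (1 - q ^ 2 * q ^ r * a * q ^ m) * (A * (1 - q * q ^ r * a * q ^ m)) := by ring
    _ = _ := by rw [e1, e2]; ring

theorem poisedCoeff_zero_left (z q : K) (r m : ℕ) :
    poisedCoeff z q 0 r m = prefactor z q 0 r *
      ((1 - z ^ 2 * (q ^ m) ^ 2) / (1 - z ^ 2) * (poisedQuot (z ^ 2) q r m * (-q ^ r) ^ m)) := by
  rw [poisedCoeff, Nat.cast_zero, sub_zero, zpow_natCast, mul_assoc ((1 - _) / _), mul_comm 2 m,
    pow_mul]

/-- A telescoping certificate: the difference in `r` of the summands is itself a difference in `m`,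
so its partial sums have a closed form, verified by induction on `M`. -/
theorem sum_poisedCoeff_zero_succ_sub {z q : K} (hq : q ≠ 0) (hneg : ∀ d : ℤ, 1 + q ^ d ≠ 0)
    (hroot : ∀ k : ℕ, q ^ (k + 1) ≠ 1) (hz : ∀ k : ℕ, z ^ 2 * q ^ k ≠ 1) (r M : ℕ) :
    ∑ m ∈ Finset.range (M + 1), (poisedCoeff z q 0 (r + 1) m - poisedCoeff z q 0 r m) =
      -(prefactor z q 0 r / (1 - z ^ 2) * (poisedQuot (z ^ 2) q r M * (-q ^ r) ^ M) *
        ((1 - z ^ 2 * q ^ M) * q ^ r * (1 - z ^ 2 * q * (q ^ M) ^ 2) /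
          ((1 + q ^ r) * (1 - q * q ^ r * z ^ 2 * q ^ M)))) := by
  have n1 : 1 + q ^ r ≠ 0 := by simpa using hneg r
  have n2 : 1 - z ^ 2 ≠ 0 := sub_ne_zero.2 fun h => hz 0 (by rw [← h]; ring)
  have n3 : 1 - q * q ^ r * z ^ 2 ≠ 0 :=
    sub_ne_zero.2 fun h => hz (r + 1) (by rw [h]; ring)
  induction M with
  | zero =>
    rw [Finset.sum_range_one, poisedCoeff_zero_left, poisedCoeff_zero_left,
      prefactor_zero_succ hq hneg hz]
    simp only [poisedQuot, qPoch_zero, pow_zero, mul_one, div_one, one_pow]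
    generalize q ^ r = R at *
    generalize hV : 1 - q * R * z ^ 2 = V at *
    field_simp
    subst hV
    ring
  | succ M ih =>
    have n4 : 1 - q * q ^ r * z ^ 2 * q ^ M ≠ 0 :=
      sub_ne_zero.2 fun h => hz (r + 1 + M) (by rw [h]; ring)
    have n5 : 1 - q ^ 2 * q ^ r * z ^ 2 * q ^ M ≠ 0 :=
      sub_ne_zero.2 fun h => hz (r + 2 + M) (by rw [h]; ring)
    have n6 : 1 - q * q ^ M ≠ 0 := sub_ne_zero.2 fun h => hroot M (by rw [h]; ring)
    rw [Finset.sum_range_succ, ih, poisedCoeff_zero_left, poisedCoeff_zero_left,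
      prefactor_zero_succ hq hneg hz, poisedQuot_succ_succ hq hroot hz, poisedQuot_succ hq hroot hz,
      pow_succ' q M]
    generalize poisedQuot (z ^ 2) q r M * (-q ^ r) ^ M = h
    generalize prefactor z q 0 r = p
    generalize q ^ r = R at *
    generalize q ^ M = Q at *
    generalize z ^ 2 = a at *
    have n7 : 1 - q * R * a * (q * Q) ≠ 0 := by
      rwa [show q * R * a * (q * Q) = q ^ 2 * R * a * Q by ring]
    rw [show 1 - q ^ 2 * R * a * Q = 1 - q * R * a * (q * Q) by ring]
    -- Each denominator becomes an atom known to be nonzero, so that `field_simp` clears it whole;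
    -- substituting back leaves a polynomial identity.
    generalize hX : 1 - q * R * a * (q * Q) = X at *
    generalize hY : 1 - q * R * a * Q = Y at *
    generalize hW : 1 - q * Q = W at *
    generalize hV : 1 - q * R * a = V at *
    generalize hU : 1 - a = U at *
    generalize hT : 1 + R = T at *
    field_simp
    subst hX hY hW hV hU hT
    ring

theorem sum_poisedCoeff_zero {z q : K} (hq : q ≠ 0) (hneg : ∀ d : ℤ, 1 + q ^ d ≠ 0)
    (hroot : ∀ k : ℕ, q ^ (k + 1) ≠ 1) (hz : ∀ k : ℕ, z ^ 2 * q ^ k ≠ 1) (r : ℕ) :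
    ∑ m ∈ Finset.range (r + 1), poisedCoeff z q 0 r m = 1 := by
  induction r with
  | zero =>
    have n2 : 1 - z ^ 2 ≠ 0 := sub_ne_zero.2 fun h => hz 0 (by rw [← h]; ring)
    simp [poisedCoeff, prefactor, poisedQuot, qPoch_zero, qPochInt, n2]
  | succ r ih =>
    have h := sum_poisedCoeff_zero_succ_sub hq hneg hroot hz r (r + 1)
    -- The factor `1 - q^(-r) q^r` kills this quotient. Hence both the telescoped value at `M = r +
    -- 1` and the surplus term `m = r + 1` of the sum for `r` vanish.
    have h0 : poisedQuot (z ^ 2) q r (r + 1) = 0 := by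
      rw [poisedQuot, qPoch_zpow_neg_eq_zero hq (Nat.lt_succ_self r)]; simp
    rw [Finset.sum_sub_distrib, Finset.sum_range_succ _ (r + 1),
      Finset.sum_range_succ (fun m => poisedCoeff z q 0 r m) (r + 1), ih,
      ← Finset.sum_range_succ (fun m => poisedCoeff z q 0 (r + 1) m) (r + 1),
      poisedCoeff_zero_left z q r (r + 1), h0] at h
    linear_combination h

end Summation

/-! ### Pairing the two signs of one variable. -/

section SignSums

open Polynomial

variable {K : Type*} [Field K]

/-- By symmetry of `g` the product runs over unordered pairs, so the pairs containing any chosen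
index can be split off. -/
theorem Fin.prod_Ioi_succAbove {M : Type*} [CommMonoid M] {m : ℕ}
    (g : Fin (m + 1) → Fin (m + 1) → M)
    (hg : ∀ i j, g i j = g j i) (k : Fin (m + 1)) :
    ∏ i, ∏ j ∈ Finset.Ioi i, g i j =
      (∏ j, g k (k.succAbove j)) *
        ∏ i, ∏ j ∈ Finset.Ioi i, g (k.succAbove i) (k.succAbove j) := by
  have key : ∀ (p : ℕ) (f : Fin p → Fin p → M),
      ∏ i, ∏ j ∈ Finset.Ioi i, f i j = ∏ i, ∏ j, if i < j then f i j else 1 := by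
    intro p f
    refine Finset.prod_congr rfl fun i _ => ?_
    rw [← Finset.prod_filter, Finset.filter_lt_eq_Ioi]
  rw [key, key, Fin.prod_univ_succAbove _ k]
  simp only [Fin.prod_univ_succAbove _ k, lt_irrefl, if_false, one_mul,
    (Fin.strictMono_succAbove k).lt_iff_lt, Finset.prod_mul_distrib]
  rw [← mul_assoc, ← Finset.prod_mul_distrib]
  congr 1
  refine Finset.prod_congr rfl fun j _ => ?_
  rcases lt_or_gt_of_ne (Fin.succAbove_ne k j) with h | h
  · simp [h, h.not_gt, hg k]
  · simp [h, h.not_gt]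

theorem sum_signs_insertNth {m : ℕ} (k : Fin (m + 1)) (f : (Fin (m + 1) → ℤˣ) → K) :
    ∑ σ, f σ = ∑ τ : Fin m → ℤˣ,
      (f (k.insertNth (α := fun _ => ℤˣ) 1 τ) + f (k.insertNth (α := fun _ => ℤˣ) (-1) τ)) := by
  rw [← (Fin.insertNthEquiv (fun _ => ℤˣ) k).sum_comp, Fintype.sum_prod_type, Finset.sum_add_distrib]
  have : (Finset.univ : Finset ℤˣ) = {1, -1} := rfl
  rw [this, Finset.sum_pair (by decide)]
  rfl

/-- The vector `(x_i^{σ_i})_i`. -/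
def signPow {m : ℕ} (x : Fin m → K) (σ : Fin m → ℤˣ) (i : Fin m) : K := x i ^ (σ i : ℤ)

theorem signPow_insertNth_self {m : ℕ} (x : Fin (m + 1) → K) (k : Fin (m + 1)) (a : ℤˣ)
    (τ : Fin m → ℤˣ) :
    signPow x (k.insertNth (α := fun _ => ℤˣ) a τ) k = x k ^ (a : ℤ) := by
  simp [signPow]

theorem signPow_insertNth_succAbove {m : ℕ} (x : Fin (m + 1) → K) (k : Fin (m + 1)) (a : ℤˣ)
    (τ : Fin m → ℤˣ) (j : Fin m) :
    signPow x (k.insertNth (α := fun _ => ℤˣ) a τ) (k.succAbove j) =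
      signPow (fun i => x (k.succAbove i)) τ j := by
  simp [signPow]

/-- The summand of the sum over signs, multiplied by `∏ (1 - z x_i) (1 - z / x_i)`, as a function
of `u_i = x_i^{σ_i}`, with `Z` for `q^r z`. -/
def signTerm (q z Z : K) {m : ℕ} (u : Fin m → K) : K :=
  (∏ i, ((1 - q * u i ^ 2) / (1 - u i ^ 2) * ((1 - Z / u i) * (1 - z * u i)))) *
    ∏ i, ∏ j ∈ Finset.Ioi i, ((1 - q * u i * u j) / (1 - u i * u j))

theorem signTerm_succAbove (q z Z : K) {m : ℕ} (u : Fin (m + 1) → K) (k : Fin (m + 1)) :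
    signTerm q z Z u =
      (1 - q * u k ^ 2) / (1 - u k ^ 2) * ((1 - Z / u k) * (1 - z * u k)) *
        (∏ j, (1 - q * u k * u (k.succAbove j)) / (1 - u k * u (k.succAbove j))) *
        signTerm q z Z (fun i => u (k.succAbove i)) := by
  rw [signTerm, signTerm, Fin.prod_Ioi_succAbove _ _ k, Fin.prod_univ_succAbove _ k]
  · ring
  · intro i j; rw [mul_right_comm, mul_comm (u i)]

/-- The numerator of `signTerm` at `(t, u)` plus `signTerm` at `(1/t, u)`, divided by `signTerm`
at `u`, as a polynomial in `t`. -/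
noncomputable def pairNum (q z Z : K) {m : ℕ} (u : Fin m → K) : K[X] :=
  (1 - C q * X ^ 2) * (X - C Z) * (1 - C z * X) *
      (∏ j, ((1 - C (q * u j) * X) * (1 - C (u j)⁻¹ * X))) -
    (X ^ 2 - C q) * (1 - C Z * X) * (X - C z) *
      ∏ j, ((C q - C (u j)⁻¹ * X) * (1 - C (u j) * X))

theorem eval_pairNum (q z Z t : K) {m : ℕ} (u : Fin m → K) :
    (pairNum q z Z u).eval t =
      (1 - q * t ^ 2) * (t - Z) * (1 - z * t) *
          (∏ j, ((1 - q * u j * t) * (1 - (u j)⁻¹ * t))) -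
        (t ^ 2 - q) * (1 - Z * t) * (t - z) *
          ∏ j, ((q - (u j)⁻¹ * t) * (1 - u j * t)) := by
  simp [pairNum, eval_prod]

theorem natDegree_pairNum_le (q z Z : K) {m : ℕ} (u : Fin m → K) :
    (pairNum q z Z u).natDegree ≤ 2 * m + 4 := by
  have h : ∀ f : Fin m → K[X], (∀ j, (f j).natDegree ≤ 2) → (∏ j, f j).natDegree ≤ 2 * m := by
    intro f hf
    refine (natDegree_prod_le _ _).trans ((Finset.sum_le_card_nsmul _ _ 2 fun j _ => hf j).trans ?_)
    simp [mul_comm]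
  have h1 : (∏ j, ((1 - C (q * u j) * X) * (1 - C (u j)⁻¹ * X))).natDegree ≤ 2 * m :=
    h _ fun j => by compute_degree
  have h2 : (∏ j, ((C q - C (u j)⁻¹ * X) * (1 - C (u j) * X))).natDegree ≤ 2 * m :=
    h _ fun j => by compute_degree
  refine (natDegree_sub_le _ _).trans (max_le ?_ ?_)
  · refine natDegree_mul_le.trans ?_
    have : ((1 - C q * X ^ 2) * (X - C Z) * (1 - C z * X)).natDegree ≤ 4 := by compute_degree
    omega
  · refine natDegree_mul_le.trans ?_
    have : ((X ^ 2 - C q) * (1 - C Z * X) * (X - C z)).natDegree ≤ 4 := by compute_degree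
    omega

theorem eval_zero_pairNum (q z Z : K) {m : ℕ} (u : Fin m → K) :
    (pairNum q z Z u).eval 0 = -(Z + z * q ^ (m + 1)) := by
  rw [eval_pairNum]; simp; ring

/-- When `t = 1/t`, the two products in `pairNum` agree factor by factor and so do their prefactors;
the final cofactor is the quotient of the remaining difference by `t^2 - 1`. -/
theorem eval_pairNum_of_sq_eq_one {q z Z t : K} (ht : t ^ 2 = 1) {m : ℕ} {u : Fin m → K}
    (hu : ∀ j, u j ≠ 0) : (pairNum q z Z u).eval t = 0 := by
  have h : ∏ j, ((q - (u j)⁻¹ * t) * (1 - u j * t)) =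
      ∏ j, ((1 - q * u j * t) * (1 - (u j)⁻¹ * t)) := by
    refine Finset.prod_congr rfl fun j _ => ?_
    have := hu j
    field_simp
    linear_combination (u j - q * u j) * ht
  rw [eval_pairNum, h]
  generalize (∏ j, ((1 - q * u j * t) * (1 - (u j)⁻¹ * t))) = P
  linear_combination (P * (-q * (t - Z) * (1 - z * t) - (1 - Z * t) * (t - z) +
    (1 - q) * (Z - z))) * ht

/-- The multiplier clears the denominators of both signs at once, since `1 - u/t` is `1 - t/u` up to
a monomial. This is the origin of `pairNum`. -/
theorem signTerm_pair {q z Z t : K} {m : ℕ} (u : Fin m → K) (ht : t ≠ 0) (ht2 : 1 - t ^ 2 ≠ 0)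
    (hu : ∀ j, u j ≠ 0) (h1 : ∀ j, 1 - u j * t ≠ 0) (h2 : ∀ j, 1 - (u j)⁻¹ * t ≠ 0) :
    ((1 - q * t ^ 2) / (1 - t ^ 2) * ((1 - Z / t) * (1 - z * t)) *
        (∏ j, (1 - q * t * u j) / (1 - t * u j)) +
      (1 - q * t⁻¹ ^ 2) / (1 - t⁻¹ ^ 2) * ((1 - Z / t⁻¹) * (1 - z * t⁻¹)) *
        (∏ j, (1 - q * t⁻¹ * u j) / (1 - t⁻¹ * u j))) *
      (t * ((1 - t ^ 2) * ∏ j, ((1 - u j * t) * (1 - (u j)⁻¹ * t)))) =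
    (pairNum q z Z u).eval t := by
  have e1 : (∏ j, (1 - q * t * u j) / (1 - t * u j)) * (∏ j, ((1 - u j * t) * (1 - (u j)⁻¹ * t))) =
      ∏ j, ((1 - q * u j * t) * (1 - (u j)⁻¹ * t)) := by
    rw [← Finset.prod_mul_distrib]
    refine Finset.prod_congr rfl fun j _ => ?_
    have := h1 j
    rw [mul_comm t (u j), mul_right_comm q]
    rw [← mul_assoc, div_mul_cancel₀ _ this]
  have e2 : (∏ j, (1 - q * t⁻¹ * u j) / (1 - t⁻¹ * u j)) *
      (∏ j, ((1 - u j * t) * (1 - (u j)⁻¹ * t))) = ∏ j, ((q - (u j)⁻¹ * t) * (1 - u j * t)) := by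
    rw [← Finset.prod_mul_distrib]
    refine Finset.prod_congr rfl fun j _ => ?_
    have h3 : 1 - t⁻¹ * u j ≠ 0 := by
      intro h
      apply h2 j
      have h4 := hu j
      field_simp at h ⊢
      linear_combination -h
    have h4 := hu j
    have h5 : (1 - q * t⁻¹ * u j) / (1 - t⁻¹ * u j) * (1 - (u j)⁻¹ * t) = q - (u j)⁻¹ * t := by
      rw [div_mul_eq_mul_div, div_eq_iff h3]
      field_simp
      ring
    rw [← h5]; ring
  have e3 : (1 - q * t⁻¹ ^ 2) / (1 - t⁻¹ ^ 2) * (1 - t ^ 2) = q - t ^ 2 := by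
    have h3 : 1 - t⁻¹ ^ 2 ≠ 0 := by
      intro h; apply ht2; field_simp at h; linear_combination -h
    rw [div_mul_eq_mul_div, div_eq_iff h3]
    field_simp
    ring
  have e4 : (1 - q * t ^ 2) / (1 - t ^ 2) * (1 - t ^ 2) = 1 - q * t ^ 2 := div_mul_cancel₀ _ ht2
  have e5 : (1 - Z / t) * t = t - Z := by field_simp
  have e6 : (1 - z * t⁻¹) * t = t - z := by field_simp
  have e7 : Z / t⁻¹ = Z * t := by simp
  rw [eval_pairNum, ← e1, ← e2, e7]
  generalize (∏ j, (1 - q * t * u j) / (1 - t * u j)) = A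
  generalize (∏ j, (1 - q * t⁻¹ * u j) / (1 - t⁻¹ * u j)) = B
  generalize (∏ j, ((1 - u j * t) * (1 - (u j)⁻¹ * t))) = D
  generalize (1 - q * t⁻¹ ^ 2) / (1 - t⁻¹ ^ 2) = G at *
  generalize (1 - q * t ^ 2) / (1 - t ^ 2) = H at *
  calc _ = (H * (1 - t ^ 2)) * ((1 - Z / t) * t) * (1 - z * t) * (A * D) +
        (G * (1 - t ^ 2)) * (1 - Z * t) * ((1 - z * t⁻¹) * t) * (B * D) := by ring
    _ = _ := by rw [e3, e4, e5, e6]; ring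

/-- Cancellation of the apparent poles at `t = u_k`. For `u` the first product of `pairNum` has a
zero factor, for `u'` the second. The two surviving products, multiplied by the interaction factors
of the `k`-th variable, become the same product with opposite signs. -/
theorem signTerm_mul_pairNum_add {q z Z v : K} {m : ℕ} {u u' : Fin (m + 1) → K} (k : Fin (m + 1))
    (huk : u k = v) (huk' : u' k = v⁻¹) (huu : ∀ j, u' (k.succAbove j) = u (k.succAbove j))
    (hv : v ≠ 0) (hv2 : v ^ 2 ≠ 1) (hu : ∀ j, u (k.succAbove j) ≠ 0)
    (h1 : ∀ j, 1 - u (k.succAbove j) * v ≠ 0) (h2 : ∀ j, 1 - (u (k.succAbove j))⁻¹ * v ≠ 0) :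
    signTerm q z Z u * (pairNum q z Z u).eval v +
      signTerm q z Z u' * (pairNum q z Z u').eval v = 0 := by
  have hv2' : 1 - v ^ 2 ≠ 0 := sub_ne_zero.2 hv2.symm
  rw [signTerm_succAbove q z Z u k, signTerm_succAbove q z Z u' k, eval_pairNum, eval_pairNum]
  simp only [Fin.prod_univ_succAbove _ k, huk, huk', huu, inv_inv, inv_mul_cancel₀ hv, sub_self,
    mul_zero, zero_mul, zero_sub, sub_zero]
  generalize signTerm q z Z (fun i => u (k.succAbove i)) = S
  have e1 : (∏ j, (1 - q * v * u (k.succAbove j)) / (1 - v * u (k.succAbove j))) *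
      (∏ j, ((q - (u (k.succAbove j))⁻¹ * v) * (1 - u (k.succAbove j) * v))) =
      ∏ j, ((1 - q * v * u (k.succAbove j)) * (q - (u (k.succAbove j))⁻¹ * v)) := by
    rw [← Finset.prod_mul_distrib]
    refine Finset.prod_congr rfl fun j _ => ?_
    have := h1 j
    rw [mul_comm v (u _), mul_comm (q - _), ← mul_assoc, div_mul_cancel₀ _ this]
  have e2 : (∏ j, (1 - q * v⁻¹ * u (k.succAbove j)) / (1 - v⁻¹ * u (k.succAbove j))) *
      (∏ j, ((1 - q * u (k.succAbove j) * v) * (1 - (u (k.succAbove j))⁻¹ * v))) =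
      ∏ j, ((1 - q * v * u (k.succAbove j)) * (q - (u (k.succAbove j))⁻¹ * v)) := by
    rw [← Finset.prod_mul_distrib]
    refine Finset.prod_congr rfl fun j _ => ?_
    have h4 := hu j
    have h3 : 1 - v⁻¹ * u (k.succAbove j) ≠ 0 := by
      intro h
      apply h2 j
      field_simp at h ⊢
      linear_combination -h
    have h5 : (1 - q * v⁻¹ * u (k.succAbove j)) / (1 - v⁻¹ * u (k.succAbove j)) *
        (1 - (u (k.succAbove j))⁻¹ * v) = q - (u (k.succAbove j))⁻¹ * v := by
      rw [div_mul_eq_mul_div, div_eq_iff h3]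
      field_simp
      ring
    rw [← h5]; ring
  have e3 : (1 - q * v⁻¹ ^ 2) / (1 - v⁻¹ ^ 2) * (1 - v ^ 2) = q - v ^ 2 := by
    have h3 : 1 - v⁻¹ ^ 2 ≠ 0 := by
      intro h; apply hv2'; field_simp at h; linear_combination -h
    rw [div_mul_eq_mul_div, div_eq_iff h3]
    field_simp
    ring
  generalize (∏ j, (1 - q * v * u (k.succAbove j)) / (1 - v * u (k.succAbove j))) = A at *
  generalize (∏ j, (1 - q * v⁻¹ * u (k.succAbove j)) / (1 - v⁻¹ * u (k.succAbove j))) = B at *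
  generalize (∏ j, ((q - (u (k.succAbove j))⁻¹ * v) * (1 - u (k.succAbove j) * v))) = A' at *
  generalize (∏ j, ((1 - q * u (k.succAbove j) * v) * (1 - (u (k.succAbove j))⁻¹ * v))) = B' at *
  generalize (∏ j, ((1 - q * v * u (k.succAbove j)) * (q - (u (k.succAbove j))⁻¹ * v))) = E at *
  have e4 : (1 - q * v ^ 2) / (1 - v ^ 2) * (1 - v ^ 2) = 1 - q * v ^ 2 := div_mul_cancel₀ _ hv2'
  have e5 : Z / v⁻¹ = Z * v := by simp
  have e6 : (1 - Z / v) * v = v - Z := by field_simp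
  have e7 : (1 - z * v⁻¹) * v = v - z := by field_simp
  have e8 : q * v⁻¹ * v = q := by field_simp
  rw [e5, e8]
  generalize (1 - q * v⁻¹ ^ 2) / (1 - v⁻¹ ^ 2) = G at *
  generalize (1 - q * v ^ 2) / (1 - v ^ 2) = H at *
  calc _ = S * (1 - q) * (1 - z * v) * (1 - Z * v) * (H * (1 - v ^ 2) * (v ^ 2 - q) * (v - z) *
        (1 - Z / v) * (A * A') + (1 - q * v ^ 2) * (G * (1 - v ^ 2)) * (1 - z * v⁻¹) * (v - Z) *
        (B * B')) := by ring
    _ = 0 := by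
      rw [e1, e2, e3, e4, ← e6, ← e7]; ring

end SignSums

/-! ### Interpolation in one variable, for parameters in general position. -/

section Generic

open Polynomial

variable {K : Type*} [Field K]

theorem signPow_eq_or {m : ℕ} (x : Fin m → K) (σ : Fin m → ℤˣ) (j : Fin m) :
    signPow x σ j = x j ∨ signPow x σ j = (x j)⁻¹ := by
  rcases Int.units_eq_one_or (σ j) with h | h <;> simp [signPow, h]

theorem sum_signTerm_mul_pairNum_eq_zero {q z Z v : K} {m : ℕ} {x : Fin m → K} (hx : ∀ i, x i ≠ 0)
    (hx_sq : ∀ i, x i ^ 2 ≠ 1) (hx_mul : ∀ i j, i ≠ j → x i * x j ≠ 1)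
    (hx_ne : ∀ i j, i ≠ j → x i ≠ x j) (k : Fin m) (hv : v = x k ∨ v = (x k)⁻¹) :
    ∑ τ, signTerm q z Z (signPow x τ) * (pairNum q z Z (signPow x τ)).eval v = 0 := by
  rcases m with _ | m
  · exact k.elim0
  have hv0 : v ≠ 0 := by rcases hv with rfl | rfl <;> simp [hx]
  have hv2 : v ^ 2 ≠ 1 := by rcases hv with rfl | rfl <;> simp [hx_sq]
  have h0 : ∀ (τ : Fin m → ℤˣ) j, signPow (fun i => x (k.succAbove i)) τ j ≠ 0 := fun τ j => by
    rcases signPow_eq_or (fun i => x (k.succAbove i)) τ j with h | h <;> simp [h, hx]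
  have hne : ∀ j, x (k.succAbove j) ≠ x k := fun j => hx_ne _ _ (Fin.succAbove_ne k j)
  have hmul : ∀ j, x (k.succAbove j) * x k ≠ 1 := fun j => hx_mul _ _ (Fin.succAbove_ne k j)
  have h3 : ∀ j, x (k.succAbove j) ≠ v ∧ x (k.succAbove j) * v ≠ 1 := fun j => by
    have h5 := hx k
    rcases hv with rfl | rfl
    · exact ⟨hne j, hmul j⟩
    · refine ⟨fun h => hmul j ?_, fun h => hne j ?_⟩
      · rw [h, inv_mul_cancel₀ h5]
      · rwa [mul_inv_eq_one₀ h5] at h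
  have h1 : ∀ (τ : Fin m → ℤˣ) j, 1 - signPow (fun i => x (k.succAbove i)) τ j * v ≠ 0 := by
    intro τ j
    have h5 := hx (k.succAbove j)
    rw [sub_ne_zero]
    rcases signPow_eq_or (fun i => x (k.succAbove i)) τ j with h | h <;> rw [h]
    · exact (h3 j).2.symm
    · intro h6
      rw [eq_comm, inv_mul_eq_one₀ h5] at h6
      exact (h3 j).1 h6
  have h2 : ∀ (τ : Fin m → ℤˣ) j, 1 - (signPow (fun i => x (k.succAbove i)) τ j)⁻¹ * v ≠ 0 := by
    intro τ j
    have h5 := hx (k.succAbove j)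
    rw [sub_ne_zero]
    rcases signPow_eq_or (fun i => x (k.succAbove i)) τ j with h | h <;> rw [h]
    · intro h6
      rw [eq_comm, inv_mul_eq_one₀ h5] at h6
      exact (h3 j).1 h6
    · rw [inv_inv]
      exact (h3 j).2.symm
  rw [sum_signs_insertNth k]
  refine Finset.sum_eq_zero fun τ _ => ?_
  rcases hv with hv | hv
  · refine signTerm_mul_pairNum_add k ?_ ?_ (fun j => ?_) hv0 hv2 (fun j => ?_) (fun j => ?_)
      (fun j => ?_)
    · simp [signPow_insertNth_self, hv]
    · simp [signPow_insertNth_self, hv]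
    · rw [signPow_insertNth_succAbove, signPow_insertNth_succAbove]
    all_goals rw [signPow_insertNth_succAbove]
    exacts [h0 τ j, h1 τ j, h2 τ j]
  -- Now the vector with sign `-1` at `k` has `k`-th entry `v`, so the two terms exchange roles.
  · rw [add_comm]
    refine signTerm_mul_pairNum_add k ?_ ?_ (fun j => ?_) hv0 hv2 (fun j => ?_) (fun j => ?_)
      (fun j => ?_)
    · simp [signPow_insertNth_self, hv]
    · simp [signPow_insertNth_self, hv]
    · rw [signPow_insertNth_succAbove, signPow_insertNth_succAbove]
    all_goals rw [signPow_insertNth_succAbove]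
    exacts [h0 τ j, h1 τ j, h2 τ j]

/-- The part of the sum over signs in which the variable `t` has sign `+1`. -/
def halfSum (q z Z t : K) {m : ℕ} (x : Fin m → K) : K :=
  ∑ τ, (1 - q * t ^ 2) / (1 - t ^ 2) * ((1 - Z / t) * (1 - z * t)) *
    (∏ j, (1 - q * t * signPow x τ j) / (1 - t * signPow x τ j)) * signTerm q z Z (signPow x τ)

theorem sum_signTerm_succ (q z Z : K) {m : ℕ} (x : Fin (m + 1) → K) :
    ∑ σ, signTerm q z Z (signPow x σ) =
      halfSum q z Z (x 0) (fun j => x j.succ) + halfSum q z Z (x 0)⁻¹ (fun j => x j.succ) := by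
  rw [sum_signs_insertNth 0, halfSum, halfSum, ← Finset.sum_add_distrib]
  refine Finset.sum_congr rfl fun τ _ => ?_
  rw [signTerm_succAbove _ _ _ _ 0, signTerm_succAbove _ _ _ (signPow x _) 0]
  simp only [signPow_insertNth_self, signPow_insertNth_succAbove]
  simp

theorem prod_signPow_symm {m : ℕ} (x : Fin m → K) (τ : Fin m → ℤˣ) (t : K) :
    ∏ j, ((1 - signPow x τ j * t) * (1 - (signPow x τ j)⁻¹ * t)) =
      ∏ j, ((1 - x j * t) * (1 - (x j)⁻¹ * t)) := by
  refine Finset.prod_congr rfl fun j _ => ?_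
  rcases signPow_eq_or x τ j with h | h <;> rw [h]
  rw [inv_inv, mul_comm]

theorem halfSum_add_halfSum_inv_mul {q z Z t : K} {m : ℕ} {x : Fin m → K} (ht : t ≠ 0)
    (ht2 : t ^ 2 ≠ 1) (hx : ∀ j, x j ≠ 0) (h1 : ∀ j, x j * t ≠ 1) (h2 : ∀ j, x j ≠ t) :
    (halfSum q z Z t x + halfSum q z Z t⁻¹ x) *
        (t * ((1 - t ^ 2) * ∏ j, ((1 - x j * t) * (1 - (x j)⁻¹ * t)))) =
      ∑ τ, signTerm q z Z (signPow x τ) * (pairNum q z Z (signPow x τ)).eval t := by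
  rw [halfSum, halfSum, ← Finset.sum_add_distrib, Finset.sum_mul]
  refine Finset.sum_congr rfl fun τ _ => ?_
  have h3 : ∀ j, 1 - x j * t ≠ 0 := fun j => sub_ne_zero.2 (h1 j).symm
  have h4 : ∀ j, 1 - (x j)⁻¹ * t ≠ 0 := fun j => sub_ne_zero.2 fun h => by
    rw [eq_comm, inv_mul_eq_one₀ (hx j)] at h
    exact h2 j h
  rw [← signTerm_pair (signPow x τ) ht (sub_ne_zero.2 ht2.symm), prod_signPow_symm]
  · ring
  all_goals intro j
  all_goals rcases signPow_eq_or x τ j with h | h <;> rw [h]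
  · exact hx j
  · exact inv_ne_zero (hx j)
  · exact h3 j
  · exact h4 j
  · exact h4 j
  · rw [inv_inv]; exact h3 j

/-- At `t = z` the interaction factors `(1 - q z u_j) / (1 - z u_j)` turn `1 - z u_j` into `1 - q z
u_j`, which shifts `z` to `q z` but keeps `q^r z`. Since `q^r z = q^(r-1) (q z)` for positive `r`,
this is an instance with `r - 1`. -/
theorem halfSum_self {q z : K} (r : ℕ) {m : ℕ} {x : Fin m → K} (hz : z ≠ 0) (hz2 : z ^ 2 ≠ 1)
    (h1 : ∀ j, z * x j ≠ 1) (h2 : ∀ j, z ≠ x j) (hx : ∀ j, x j ≠ 0) :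
    halfSum q z (q ^ r * z) z x =
      (1 - q * z ^ 2) * (1 - q ^ r) * ∑ τ, signTerm q (q * z) (q ^ r * z) (signPow x τ) := by
  rw [halfSum, Finset.mul_sum]
  refine Finset.sum_congr rfl fun τ _ => ?_
  have h3 : ∀ j, 1 - z * signPow x τ j ≠ 0 := fun j => sub_ne_zero.2 fun h => by
    rcases signPow_eq_or x τ j with h' | h' <;> rw [h'] at h
    · exact h1 j h.symm
    · exact h2 j ((mul_inv_eq_one₀ (hx j)).1 h.symm)
  have h4 : (1 - q * z ^ 2) / (1 - z ^ 2) * (1 - z * z) = 1 - q * z ^ 2 := by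
    rw [← sq, div_mul_cancel₀ _ (sub_ne_zero.2 hz2.symm)]
  rw [mul_div_cancel_right₀ _ hz, signTerm, signTerm]
  have h5 : (∏ j, (1 - q * z * signPow x τ j) / (1 - z * signPow x τ j)) *
      (∏ i, ((1 - q * signPow x τ i ^ 2) / (1 - signPow x τ i ^ 2) *
        ((1 - q ^ r * z / signPow x τ i) * (1 - z * signPow x τ i)))) =
      ∏ i, ((1 - q * signPow x τ i ^ 2) / (1 - signPow x τ i ^ 2) *
        ((1 - q ^ r * z / signPow x τ i) * (1 - q * z * signPow x τ i))) := by
    rw [← Finset.prod_mul_distrib]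
    refine Finset.prod_congr rfl fun j _ => ?_
    have := h3 j
    rw [mul_comm, mul_assoc, mul_assoc, mul_div_cancel₀ _ this]
  rw [← h5]
  generalize (1 - q * z ^ 2) / (1 - z ^ 2) = H at *
  generalize (∏ j, (1 - q * z * signPow x τ j) / (1 - z * signPow x τ j)) = B
  generalize (∏ i, ((1 - q * signPow x τ i ^ 2) / (1 - signPow x τ i ^ 2) *
        ((1 - q ^ r * z / signPow x τ i) * (1 - z * signPow x τ i)))) = P
  generalize (∏ i, ∏ j ∈ Finset.Ioi i, (1 - q * signPow x τ i * signPow x τ j) /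
    (1 - signPow x τ i * signPow x τ j)) = Q
  linear_combination ((1 - q ^ r) * B * P * Q) * h4

/-- The factor `1 - z t` vanishes at `t = 1/z`. -/
theorem halfSum_inv_self {q z Z : K} {m : ℕ} {x : Fin m → K} (hz : z ≠ 0) :
    halfSum q z Z z⁻¹ x = 0 := by
  simp [halfSum, hz]

/-- The parameters `q` and `z` are in general position. -/
structure GenericPair (q z : K) : Prop where
  q_ne_zero : q ≠ 0
  z_ne_zero : z ≠ 0
  one_add_ne_zero : ∀ d : ℤ, 1 + q ^ d ≠ 0
  q_pow_ne_one : ∀ k : ℕ, q ^ (k + 1) ≠ 1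
  z_sq_mul_ne_one : ∀ k : ℕ, z ^ 2 * q ^ k ≠ 1

/-- The variables `x` are in general position with respect to `q` and `z`. -/
structure GenericVars (q z : K) {n : ℕ} (x : Fin n → K) : Prop where
  ne_zero : ∀ i, x i ≠ 0
  sq_ne_one : ∀ i, x i ^ 2 ≠ 1
  mul_ne_one : ∀ i j, i ≠ j → x i * x j ≠ 1
  ne : ∀ i j, i ≠ j → x i ≠ x j
  z_mul_ne_one : ∀ (k : ℕ) (i), z * q ^ k * x i ≠ 1
  z_ne : ∀ (k : ℕ) (i), z * q ^ k ≠ x i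

theorem GenericPair.shift {q z : K} (h : GenericPair q z) : GenericPair q (q * z) where
  q_ne_zero := h.q_ne_zero
  z_ne_zero := mul_ne_zero h.q_ne_zero h.z_ne_zero
  one_add_ne_zero := h.one_add_ne_zero
  q_pow_ne_one := h.q_pow_ne_one
  z_sq_mul_ne_one k e := h.z_sq_mul_ne_one (k + 2) (by rw [← e]; ring)

theorem GenericVars.shift {q z : K} {n : ℕ} {x : Fin n → K} (h : GenericVars q z x) :
    GenericVars q (q * z) x where
  ne_zero := h.ne_zero
  sq_ne_one := h.sq_ne_one
  mul_ne_one := h.mul_ne_one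
  ne := h.ne
  z_mul_ne_one k i e := h.z_mul_ne_one (k + 1) i (by rw [← e]; ring)
  z_ne k i e := h.z_ne (k + 1) i (by rw [← e]; ring)

theorem GenericVars.tail {q z : K} {n : ℕ} {x : Fin (n + 1) → K} (h : GenericVars q z x) :
    GenericVars q z (fun i => x i.succ) where
  ne_zero i := h.ne_zero i.succ
  sq_ne_one i := h.sq_ne_one i.succ
  mul_ne_one _ _ hij := h.mul_ne_one _ _ fun e => hij (Fin.succ_injective _ e)
  ne _ _ hij := h.ne _ _ fun e => hij (Fin.succ_injective _ e)
  z_mul_ne_one k i := h.z_mul_ne_one k i.succ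
  z_ne k i := h.z_ne k i.succ

/-- `∏ (1 - z q^m x_i) (1 - z q^m / x_i)`. -/
def nodeProd (q z : K) (k : ℕ) {n : ℕ} (x : Fin n → K) : K :=
  ∏ i, ((1 - z * q ^ k * x i) * (1 - z * q ^ k / x i))

/-- The difference of the two sides of the expansion, multiplied by the denominators, as a
polynomial in the first variable. -/
noncomputable def expansionDefect (q z : K) (r : ℕ) {n : ℕ} (x : Fin n → K) : K[X] :=
  (∑ τ, C (signTerm q z (q ^ r * z) (signPow x τ)) * pairNum q z (q ^ r * z) (signPow x τ)) -
    (1 - X ^ 2) * (∏ j, ((1 - C (x j) * X) * (1 - C (x j)⁻¹ * X))) *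
      ∑ k ∈ Finset.range (r + 1), C (poisedCoeff z q (n + 1) r k * nodeProd q z k x) *
        ((1 - C (z * q ^ k) * X) * (X - C (z * q ^ k)))

theorem eval_expansionDefect (q z t : K) (r : ℕ) {n : ℕ} (x : Fin n → K) :
    (expansionDefect q z r x).eval t =
      (∑ τ, signTerm q z (q ^ r * z) (signPow x τ) *
        (pairNum q z (q ^ r * z) (signPow x τ)).eval t) -
      (1 - t ^ 2) * (∏ j, ((1 - x j * t) * (1 - (x j)⁻¹ * t))) *
        ∑ k ∈ Finset.range (r + 1), poisedCoeff z q (n + 1) r k * nodeProd q z k x *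
          ((1 - z * q ^ k * t) * (t - z * q ^ k)) := by
  simp [expansionDefect, eval_finsetSum, eval_prod]

theorem natDegree_expansionDefect_le (q z : K) (r : ℕ) {n : ℕ} (x : Fin n → K) :
    (expansionDefect q z r x).natDegree ≤ 2 * n + 4 := by
  refine (natDegree_sub_le _ _).trans (max_le ?_ ?_)
  · refine natDegree_sum_le_of_forall_le _ _ fun τ _ => ?_
    exact (natDegree_C_mul_le _ _).trans (natDegree_pairNum_le _ _ _ _)
  · have h1 : (∏ j, ((1 - C (x j) * X) * (1 - C (x j)⁻¹ * X))).natDegree ≤ 2 * n := by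
      refine (natDegree_prod_le _ _).trans
        ((Finset.sum_le_card_nsmul _ _ 2 fun j _ => ?_).trans ?_)
      · compute_degree
      · simp [mul_comm]
    have h2 : ((1 : K[X]) - X ^ 2).natDegree ≤ 2 := by compute_degree
    have h3 : (∑ k ∈ Finset.range (r + 1), C (poisedCoeff z q (n + 1) r k * nodeProd q z k x) *
        ((1 - C (z * q ^ k) * X) * (X - C (z * q ^ k)))).natDegree ≤ 2 := by
      refine natDegree_sum_le_of_forall_le _ _ fun k _ => (natDegree_C_mul_le _ _).trans ?_
      compute_degree
    refine natDegree_mul_le.trans (Nat.add_le_add (natDegree_mul_le.trans (Nat.add_le_add h2 h1))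
      h3 |>.trans ?_)
    omega

theorem eval_expansionDefect_eq {q z t : K} (r : ℕ) {n : ℕ} {x : Fin n → K} (ht : t ≠ 0)
    (ht2 : t ^ 2 ≠ 1) (hx : ∀ j, x j ≠ 0) (h1 : ∀ j, x j * t ≠ 1) (h2 : ∀ j, x j ≠ t) :
    (expansionDefect q z r x).eval t =
      t * ((1 - t ^ 2) * ∏ j, ((1 - x j * t) * (1 - (x j)⁻¹ * t))) *
        (halfSum q z (q ^ r * z) t x + halfSum q z (q ^ r * z) t⁻¹ x -
        ∑ k ∈ Finset.range (r + 1), poisedCoeff z q (n + 1) r k *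
          ((1 - z * q ^ k * t) * (1 - z * q ^ k / t) * nodeProd q z k x)) := by
  rw [eval_expansionDefect, ← halfSum_add_halfSum_inv_mul ht ht2 hx h1 h2, mul_sub, mul_comm,
    mul_comm t, mul_assoc _ t, mul_assoc _ t, Finset.mul_sum (a := t)]
  congr 2
  refine Finset.sum_congr rfl fun k _ => ?_
  field_simp

/-- `r`, `q` and `z` are quantified inside the induction on `n` because the evaluation at `t = z`
uses the case `n` with `r - 1` and `q z`. -/
theorem sum_signTerm_eq {n : ℕ} : ∀ (r : ℕ) {q z : K} {x : Fin n → K}, GenericPair q z →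
    GenericVars q z x → ∑ σ, signTerm q z (q ^ r * z) (signPow x σ) =
      ∑ k ∈ Finset.range (r + 1), poisedCoeff z q n r k * nodeProd q z k x := by
  induction n with
  | zero =>
    intro r q z x h _
    have := sum_poisedCoeff_zero h.q_ne_zero h.one_add_ne_zero h.q_pow_ne_one h.z_sq_mul_ne_one r
    simp [signTerm, nodeProd, this]
  | succ n ih =>
    intro r q z x h hx
    have hz0 := h.z_ne_zero
    have hz2 : z ^ 2 ≠ 1 := by simpa using h.z_sq_mul_ne_one 0
    have hx' := hx.tail
    have hzm : ∀ j, z * x j ≠ 1 := fun j => by simpa using hx.z_mul_ne_one 0 j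
    have hzn : ∀ j, z ≠ x j := fun j => by simpa using hx.z_ne 0 j
    -- The identity at `t = z`. For `r = 0` both sides are zero; otherwise the node factor `1 - z
    -- q^k / z` removes the term `k = 0`, and the remaining terms shift to the expansion for `q z`.
    have hself : halfSum q z (q ^ r * z) z (fun i => x i.succ) +
        halfSum q z (q ^ r * z) z⁻¹ (fun i => x i.succ) =
        ∑ k ∈ Finset.range (r + 1), poisedCoeff z q (n + 1) r k *
          ((1 - z * q ^ k * z) * (1 - z * q ^ k / z) * nodeProd q z k (fun i => x i.succ)) := by
      rw [halfSum_inv_self hz0, add_zero, halfSum_self r hz0 hz2 (fun j => hzm j.succ)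
        (fun j => hzn j.succ) hx'.ne_zero]
      rcases r with _ | r
      · simp [hz0]
      · rw [show q ^ (r + 1) * z = q ^ r * (q * z) by ring, ih r h.shift hx'.shift,
          Finset.sum_range_succ' _ (r + 1), Finset.mul_sum]
        simp only [pow_zero, mul_one, div_self hz0, sub_self, mul_zero, zero_mul, add_zero]
        refine Finset.sum_congr rfl fun k _ => ?_
        have e : nodeProd q z (k + 1) (fun i => x i.succ) =
            nodeProd q (q * z) k (fun i => x i.succ) := by
          simp only [nodeProd]
          rw [show z * q ^ (k + 1) = q * z * q ^ k by ring]
        rw [e, ← mul_assoc, ← poisedCoeff_succ_succ h.q_ne_zero h.q_pow_ne_one h.z_sq_mul_ne_one,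
          mul_div_cancel_left₀ _ hz0]
        ring
    have hzero : expansionDefect q z r (fun i => x i.succ) = 0 := by
      -- The `2n + 5` interpolation nodes, one more than the degree bound. Their distinctness uses
      -- `1 + q^0 ≠ 0`, which excludes characteristic two.
      let f : Fin 5 ⊕ (Fin n ⊕ Fin n) → K :=
        Sum.elim ![0, 1, -1, z, z⁻¹] (Sum.elim (fun i => x i.succ) (fun i => (x i.succ)⁻¹))
      have hinj : Function.Injective f := by
        have h2 : (1 : K) + 1 ≠ 0 := by simpa using h.one_add_ne_zero 0
        have h11 : (1 : K) ≠ -1 := fun e => h2 (by linear_combination e)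
        have hz1 : z ≠ 1 := fun e => hz2 (by rw [e]; ring)
        have hz1' : z ≠ -1 := fun e => hz2 (by rw [e]; ring)
        have hzi : z ≠ z⁻¹ := fun e => hz2 (by
          rw [sq]; nth_rewrite 2 [e]; exact mul_inv_cancel₀ hz0)
        have hzi1 : z⁻¹ ≠ 1 := by simpa using hz1
        have hzi1' : z⁻¹ ≠ -1 := fun e => hz1' (by
          rw [← inv_inv z, e]; simp)
        have hinj5 : Function.Injective ![0, 1, -1, z, z⁻¹] := by
          intro i j e
          fin_cases i <;> fin_cases j <;>
            simp_all [eq_comm]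
        have hni : ∀ i j : Fin (n + 1), x i ≠ (x j)⁻¹ := fun i j e => by
          have e' : x i * x j = 1 := by rw [e, inv_mul_cancel₀ (hx.ne_zero j)]
          by_cases hij : i = j
          · subst hij
            exact hx.sq_ne_one i (by rw [sq, e'])
          · exact hx.mul_ne_one i j hij e'
        have hxinj : Function.Injective fun i : Fin n => x i.succ := fun i j e => by
          by_contra hij
          exact hx'.ne i j hij e
        have hone : ∀ i, x i ≠ 1 ∧ x i ≠ -1 := fun i =>
          ⟨fun e => hx.sq_ne_one i (by rw [e]; ring), fun e => hx.sq_ne_one i (by rw [e]; ring)⟩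
        have hsep : ∀ i : Fin (n + 1), ∀ a : Fin 5, ![0, 1, -1, z, z⁻¹] a ≠ x i := by
          intro i a e
          fin_cases a
          · exact hx.ne_zero i e.symm
          · exact (hone i).1 e.symm
          · exact (hone i).2 e.symm
          · exact hzn i e
          · exact hzm i (by rw [← show z⁻¹ = x i from e, mul_inv_cancel₀ hz0])
        have hsep' : ∀ i : Fin (n + 1), ∀ a : Fin 5, ![0, 1, -1, z, z⁻¹] a ≠ (x i)⁻¹ := by
          intro i a e
          have e' : (![0, 1, -1, z, z⁻¹] a)⁻¹ = x i := by rw [e, inv_inv]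
          fin_cases a
          · exact hx.ne_zero i (by simpa using e'.symm)
          · exact (hone i).1 (by simpa using e'.symm)
          · exact (hone i).2 (by rw [← e']; simp)
          · exact hsep i 4 e'
          · exact hzn i (by simpa using e')
        refine hinj5.sumElim (hxinj.sumElim (inv_injective.comp hxinj) fun i j => hni _ _) ?_
        rintro a (i | i)
        · exact hsep _ a
        · exact hsep' _ a
      refine eq_zero_of_natDegree_lt_card_of_eval_eq_zero _ hinj ?_
        ((natDegree_expansionDefect_le q z r _).trans_lt (by simp; omega))
      have hpm : ∀ t : K, t ^ 2 = 1 → (expansionDefect q z r fun i => x i.succ).eval t = 0 := by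
        intro t ht
        rw [eval_expansionDefect, ht, sub_self, zero_mul, zero_mul, sub_zero]
        refine Finset.sum_eq_zero fun τ _ => ?_
        rw [eval_pairNum_of_sq_eq_one ht, mul_zero]
        intro j
        rcases signPow_eq_or (fun i => x i.succ) τ j with e | e <;> simp [e, hx.ne_zero]
      have hroot : ∀ (t : K) (k : Fin n), t = x k.succ ∨ t = (x k.succ)⁻¹ →
          (expansionDefect q z r fun i => x i.succ).eval t = 0 := by
        intro t k ht
        rw [eval_expansionDefect, sum_signTerm_mul_pairNum_eq_zero hx'.ne_zero hx'.sq_ne_one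
          hx'.mul_ne_one hx'.ne k ht, Finset.prod_eq_zero (Finset.mem_univ k), mul_zero, zero_mul,
          sub_zero]
        have := hx'.ne_zero k
        rcases ht with rfl | rfl <;> simp [this]
      rintro (a | i | i)
      · fin_cases a
        · change eval 0 _ = 0
          rw [eval_expansionDefect]
          simp only [eval_zero_pairNum, mul_zero, sub_zero, zero_sub, Finset.prod_const_one, mul_one,
            one_mul, ne_eq, OfNat.ofNat_ne_zero, not_false_eq_true, zero_pow]
          rw [← Finset.sum_mul, ih r h hx', Finset.sum_mul, ← Finset.sum_sub_distrib]
          refine Finset.sum_eq_zero fun k _ => ?_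
          linear_combination (z * nodeProd q z k (fun i => x i.succ)) *
            poisedCoeff_succ_left (z := z) h.q_ne_zero h.one_add_ne_zero n r k
        · exact hpm 1 (by ring)
        · exact hpm (-1) (by ring)
        · change eval z _ = 0
          rw [eval_expansionDefect_eq r hz0 hz2 hx'.ne_zero
            (fun j => by rw [mul_comm]; exact hzm j.succ) (fun j => (hzn j.succ).symm), hself,
            sub_self, mul_zero]
        -- The bracket in `eval_expansionDefect_eq` is invariant under `t ↦ 1/t`, so the computation
        -- at `z` applies again.
        · change eval z⁻¹ _ = 0
          rw [eval_expansionDefect_eq r (inv_ne_zero hz0) (by simpa using hz2) hx'.ne_zero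
            (fun j e => hzn j.succ ((mul_inv_eq_one₀ hz0).1 e).symm)
            (fun j e => hzm j.succ (by rw [e, mul_inv_cancel₀ hz0])), inv_inv, add_comm, hself]
          refine mul_eq_zero_of_right _ (sub_eq_zero.2 (Finset.sum_congr rfl fun k _ => ?_))
          rw [div_inv_eq_mul, ← div_eq_mul_inv]
          ring
      · exact hroot _ i (Or.inl rfl)
      · exact hroot _ i (Or.inr rfl)
    have h0 := hx.ne_zero 0
    have h02 := hx.sq_ne_one 0
    have hm : ∀ j : Fin n, x j.succ * x 0 ≠ 1 := fun j => hx.mul_ne_one _ _ (Fin.succ_ne_zero j)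
    have hn : ∀ j : Fin n, x j.succ ≠ x 0 := fun j => hx.ne _ _ (Fin.succ_ne_zero j)
    -- At `t = x 0` the clearing multiplier is nonzero, so vanishing of the polynomial gives the
    -- identity itself.
    have key := eval_expansionDefect_eq (q := q) (z := z) r h0 h02 hx'.ne_zero hm hn
    rw [hzero, eval_zero, eq_comm, mul_eq_zero, or_iff_right, sub_eq_zero] at key
    · rw [sum_signTerm_succ, key]
      refine Finset.sum_congr rfl fun k _ => ?_
      rw [nodeProd, nodeProd, Fin.prod_univ_succ]
    · refine mul_ne_zero h0 (mul_ne_zero (sub_ne_zero.2 h02.symm) ?_)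
      refine Finset.prod_ne_zero_iff.2 fun j _ => mul_ne_zero (sub_ne_zero.2 (hm j).symm) ?_
      refine sub_ne_zero.2 fun e => hn j ?_
      rwa [eq_comm, inv_mul_eq_one₀ (hx'.ne_zero j)] at e

end Generic

/-! ### Specialization of fractions along a ring homomorphism. -/

section Specialization

variable {A F K : Type*} [CommRing A] [Field F] [Algebra A F] [Field K]

/-- `f` is a fraction of elements of `A` whose denominator is not in the kernel of `φ`, and `k` is
its value under `φ`. -/
def IsSpecialization (φ : A →+* K) (f : F) (k : K) : Prop :=
  ∃ a b : A, φ b ≠ 0 ∧ f * algebraMap A F b = algebraMap A F a ∧ k * φ b = φ a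

namespace IsSpecialization

variable {φ : A →+* K} {f g : F} {k l : K}

theorem of_algebraMap (φ : A →+* K) (a : A) : IsSpecialization φ (algebraMap A F a) (φ a) :=
  ⟨a, 1, by simp, by simp, by simp⟩

theorem one : IsSpecialization φ (1 : F) 1 := by
  simpa using of_algebraMap (F := F) φ 1

theorem zero : IsSpecialization φ (0 : F) 0 := by
  simpa using of_algebraMap (F := F) φ 0

theorem add (hf : IsSpecialization φ f k) (hg : IsSpecialization φ g l) :
    IsSpecialization φ (f + g) (k + l) := by
  obtain ⟨a, b, hb, h1, h2⟩ := hf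
  obtain ⟨c, d, hd, h3, h4⟩ := hg
  refine ⟨a * d + c * b, b * d, by simp [hb, hd], ?_, ?_⟩
  · simp only [map_mul, map_add, ← h1, ← h3]; ring
  · simp only [map_mul, map_add, ← h2, ← h4]; ring

theorem mul (hf : IsSpecialization φ f k) (hg : IsSpecialization φ g l) :
    IsSpecialization φ (f * g) (k * l) := by
  obtain ⟨a, b, hb, h1, h2⟩ := hf
  obtain ⟨c, d, hd, h3, h4⟩ := hg
  refine ⟨a * c, b * d, by simp [hb, hd], ?_, ?_⟩
  · simp only [map_mul, ← h1, ← h3]; ring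
  · simp only [map_mul, ← h2, ← h4]; ring

theorem neg (hf : IsSpecialization φ f k) : IsSpecialization φ (-f) (-k) := by
  obtain ⟨a, b, hb, h1, h2⟩ := hf
  exact ⟨-a, b, hb, by simp [← h1], by simp [← h2]⟩

theorem sub (hf : IsSpecialization φ f k) (hg : IsSpecialization φ g l) :
    IsSpecialization φ (f - g) (k - l) := by
  simpa [sub_eq_add_neg] using hf.add hg.neg

theorem pow (hf : IsSpecialization φ f k) (m : ℕ) : IsSpecialization φ (f ^ m) (k ^ m) := by
  induction m with
  | zero => simpa using one
  | succ m ih => simpa [pow_succ] using ih.mul hf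

theorem prod {ι : Type*} (s : Finset ι) {f : ι → F} {k : ι → K}
    (h : ∀ i ∈ s, IsSpecialization φ (f i) (k i)) :
    IsSpecialization φ (∏ i ∈ s, f i) (∏ i ∈ s, k i) := by
  classical
  induction s using Finset.induction_on with
  | empty => simpa using one
  | insert i s hi ih =>
    rw [Finset.prod_insert hi, Finset.prod_insert hi]
    exact (h i (Finset.mem_insert_self i s)).mul (ih fun j hj => h j (Finset.mem_insert_of_mem hj))

theorem sum {ι : Type*} (s : Finset ι) {f : ι → F} {k : ι → K}
    (h : ∀ i ∈ s, IsSpecialization φ (f i) (k i)) :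
    IsSpecialization φ (∑ i ∈ s, f i) (∑ i ∈ s, k i) := by
  classical
  induction s using Finset.induction_on with
  | empty => simpa using zero
  | insert i s hi ih =>
    rw [Finset.sum_insert hi, Finset.sum_insert hi]
    exact (h i (Finset.mem_insert_self i s)).add (ih fun j hj => h j (Finset.mem_insert_of_mem hj))

theorem qPoch (hf : IsSpecialization φ f k) (hg : IsSpecialization φ g l) (m : ℕ) :
    IsSpecialization φ (qPoch f g m) (qPoch k l m) :=
  prod _ fun i _ => one.sub (hf.mul (hg.pow i))

variable [FaithfulSMul A F]

/-- Nonvanishing is required only of the value in `K`: it forces the numerator to be nonzero in `A`,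
hence `f ≠ 0` by injectivity of `algebraMap A F`. -/
theorem inv (hf : IsSpecialization φ f k) (hk : k ≠ 0) : IsSpecialization φ f⁻¹ k⁻¹ := by
  obtain ⟨a, b, hb, h1, h2⟩ := hf
  have ha : φ a ≠ 0 := by rw [← h2]; exact mul_ne_zero hk hb
  have ha' : algebraMap A F a ≠ 0 := by
    rw [Ne, FaithfulSMul.algebraMap_eq_zero_iff]
    rintro rfl
    simp at ha
  have hf0 : f ≠ 0 := by
    rintro rfl
    exact ha' (by rw [← h1, zero_mul])
  refine ⟨b, a, ha, ?_, ?_⟩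
  · rw [← h1, inv_mul_cancel_left₀ hf0]
  · rw [← h2, inv_mul_cancel_left₀ hk]

theorem div (hf : IsSpecialization φ f k) (hg : IsSpecialization φ g l) (hl : l ≠ 0) :
    IsSpecialization φ (f / g) (k / l) := by
  simpa [div_eq_mul_inv] using hf.mul (hg.inv hl)

theorem zpow (hf : IsSpecialization φ f k) (hk : k ≠ 0) (d : ℤ) :
    IsSpecialization φ (f ^ d) (k ^ d) := by
  rcases d with m | m
  · simpa using hf.pow m
  · simpa [zpow_negSucc] using (hf.pow (m + 1)).inv (pow_ne_zero _ hk)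

/-- Cross-multiplying two representations of `f` gives an equation in `A`, to which `φ` applies. -/
theorem unique (hf : IsSpecialization φ f k) (hg : IsSpecialization φ f l) : k = l := by
  obtain ⟨a, b, hb, h1, h2⟩ := hf
  obtain ⟨c, d, hd, h3, h4⟩ := hg
  have h : a * d = c * b := by
    apply FaithfulSMul.algebraMap_injective A F
    simp only [map_mul, ← h1, ← h3]; ring
  have h' := congrArg φ h
  simp only [map_mul, ← h2, ← h4] at h'
  apply mul_right_cancel₀ (mul_ne_zero hb hd)
  linear_combination h'

end IsSpecialization

end Specialization

/-! ### The parameters of the series, and the identity in general position. -/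

section Parameters

variable {K : Type*} [Field K]

/-- Case distinction for the indices of `lowerParams`. -/
theorem forall_lowerParams {n : ℕ} {p : Fin (n + n + 1 + 2) → Prop} (h0 : p 0) (h1 : p 1)
    (h2 : p 2) (hl : ∀ i : Fin n, p (Fin.castAdd n i).succ.succ.succ)
    (hr : ∀ i : Fin n, p (Fin.natAdd n i).succ.succ.succ) (i) : p i := by
  refine Fin.cases h0 (fun i => Fin.cases h1 (fun i => Fin.cases h2 (fun i => ?_) i) i) i
  exact Fin.addCases (motive := fun i => p i.succ.succ.succ) hl hr i

theorem isVeryWellPoised_params {n : ℕ} (r : ℕ) {x : Fin n → K} {z q : K} (hq : q ≠ 0)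
    (hx : ∀ i, x i ≠ 0) : IsVeryWellPoised (upperParams r x z q) (lowerParams r x z q) q := by
  refine ⟨forall_lowerParams ?_ ?_ ?_ (fun i => ?_) (fun i => ?_), z, rfl, rfl, rfl⟩
  · change q * z * z = q * z ^ 2
    ring
  · change -(q * z) * -z = q * z ^ 2
    ring
  · change q ^ (-(r : ℤ)) * (q ^ (r + 1) * z ^ 2) = q * z ^ 2
    rw [zpow_neg, zpow_natCast]
    have := pow_ne_zero r hq
    field_simp
    ring
  · have h1 : upperParams r x z q (Fin.castAdd n i).succ.succ.succ.succ = q * z * x i := by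
      simp [upperParams, -Fin.natAdd_eq_addNat]
    have h2 : lowerParams r x z q (Fin.castAdd n i).succ.succ.succ = z / x i := by
      simp [lowerParams, -Fin.natAdd_eq_addNat]
    have := hx i
    rw [h1, h2]
    change _ = q * z ^ 2
    field_simp
  · have h1 : upperParams r x z q (Fin.natAdd n i).succ.succ.succ.succ = q * z / x i := by
      simp [upperParams, -Fin.natAdd_eq_addNat]
    have h2 : lowerParams r x z q (Fin.natAdd n i).succ.succ.succ = z * x i := by
      simp [lowerParams, -Fin.natAdd_eq_addNat]
    have := hx i
    rw [h1, h2]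
    change _ = q * z ^ 2
    field_simp

theorem prod_upperParams {n : ℕ} (r : ℕ) (x : Fin n → K) (z q : K) (f : K → K) :
    ∏ i, f (upperParams r x z q i) =
      f (z ^ 2) * (f (q * z) * (f (-(q * z)) * (f (q ^ (-(r : ℤ))) *
        ((∏ i, f (q * z * x i)) * ∏ i, f (q * z / x i))))) := by
  rw [Fin.prod_univ_succ, Fin.prod_univ_succ, Fin.prod_univ_succ, Fin.prod_univ_succ,
    Fin.prod_univ_add]
  simp [upperParams, -Fin.natAdd_eq_addNat]

theorem prod_lowerParams {n : ℕ} (r : ℕ) (x : Fin n → K) (z q : K) (f : K → K) :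
    ∏ i, f (lowerParams r x z q i) =
      f z * (f (-z) * (f (q ^ (r + 1) * z ^ 2) *
        ((∏ i, f (z / x i)) * ∏ i, f (z * x i)))) := by
  rw [Fin.prod_univ_succ, Fin.prod_univ_succ, Fin.prod_univ_succ, Fin.prod_univ_add]
  simp [lowerParams, -Fin.natAdd_eq_addNat]

theorem qHypTerm_params_eq_zero {n r m : ℕ} (x : Fin n → K) (z : K) {q : K} (w : K) (hq : q ≠ 0)
    (h : r < m) : qHypTerm (upperParams r x z q) (lowerParams r x z q) q w m = 0 := by
  rw [qHypTerm, prod_upperParams _ _ _ _ (fun a => qPoch a q m), qPoch_zpow_neg_eq_zero hq h]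
  simp

/-- By `(1 - a) (a q;q)_m = (a;q)_m (1 - a q^m)`, each pair of parameters `q a`, `a` contributes one
linear quotient. The pairs with `a = ±z` produce the very-well-poised factor, those with `a = z x_i`
and `a = z / x_i` the node products. -/
theorem nodeProd_zero_mul_qHypTerm {q z : K} {n : ℕ} {x : Fin n → K} (h : GenericPair q z)
    (hx : GenericVars q z x) (r m : ℕ) :
    nodeProd q z 0 x * (prefactor z q n r * qHypTerm (upperParams r x z q) (lowerParams r x z q) q
      (-q ^ ((r : ℤ) - (n : ℤ))) m) = poisedCoeff z q n r m * nodeProd q z m x := by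
  have hne : ∀ {a : K}, (∀ k : ℕ, a * q ^ k ≠ 1) → qPoch a q m ≠ 0 := fun ha =>
    qPoch_ne_zero fun i _ => ha i
  have h1 : ∀ k : ℕ, z * q ^ k ≠ 1 := fun k e => h.z_sq_mul_ne_one (2 * k) (by
    rw [pow_mul', ← mul_pow, e, one_pow])
  have h2 : ∀ k : ℕ, -z * q ^ k ≠ 1 := fun k e => h.z_sq_mul_ne_one (2 * k) (by
    rw [pow_mul', ← neg_sq, ← mul_pow, e, one_pow])
  have hzx : ∀ i, ∀ k : ℕ, z * x i * q ^ k ≠ 1 := fun i k e => hx.z_mul_ne_one k i (by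
    rw [← e]; ring)
  have hzx' : ∀ i, ∀ k : ℕ, z / x i * q ^ k ≠ 1 := fun i k e => hx.z_ne k i (by
    have := hx.ne_zero i
    field_simp at e
    rw [e])
  have e1 : qPoch z q m * (1 - z * q ^ m) = (1 - z) * qPoch (q * z) q m := by
    rw [qPoch_shift, mul_comm z]
  have e2 : qPoch (-z) q m * (1 + z * q ^ m) = (1 + z) * qPoch (-(q * z)) q m := by
    have := qPoch_shift (-z) q m
    rw [show -z * q = -(q * z) by ring] at this
    linear_combination this
  have e3 : (∏ i, qPoch (z * x i) q m) * (∏ i, qPoch (z / x i) q m) * nodeProd q z m x =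
      nodeProd q z 0 x * ((∏ i, qPoch (q * z * x i) q m) * ∏ i, qPoch (q * z / x i) q m) := by
    simp only [nodeProd, ← Finset.prod_mul_distrib]
    refine Finset.prod_congr rfl fun i _ => ?_
    have s1 := qPoch_shift (z * x i) q m
    have s2 := qPoch_shift (z / x i) q m
    rw [show z * x i * q = q * z * x i by ring] at s1
    rw [show z / x i * q = q * z / x i by ring] at s2
    rw [pow_zero, mul_one]
    calc _ = (qPoch (z * x i) q m * (1 - z * x i * q ^ m)) *
          (qPoch (z / x i) q m * (1 - z / x i * q ^ m)) := by ring
      _ = _ := by rw [s1, s2]; ring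
  have n1 := hne h1
  have n2 := hne h2
  have n3 : (∏ i, qPoch (z * x i) q m) ≠ 0 := Finset.prod_ne_zero_iff.2 fun i _ => hne (hzx i)
  have n4 : (∏ i, qPoch (z / x i) q m) ≠ 0 := Finset.prod_ne_zero_iff.2 fun i _ => hne (hzx' i)
  have n5 : 1 - z ^ 2 ≠ 0 := sub_ne_zero.2 fun e => h.z_sq_mul_ne_one 0 (by rw [← e]; ring)
  rw [qHypTerm, poisedCoeff, poisedQuot, prod_upperParams _ _ _ _ (fun a => qPoch a q m),
    prod_lowerParams _ _ _ _ (fun a => qPoch a q m)]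
  have n6 : qPoch (q ^ (r + 1) * z ^ 2) q m ≠ 0 := hne fun k e => h.z_sq_mul_ne_one (r + 1 + k) (by
    rw [← e]; ring)
  have n7 : qPoch q q m ≠ 0 := hne fun k e => h.q_pow_ne_one k (by rw [← e]; ring)
  have e4 : (1 - z ^ 2 * q ^ (2 * m)) * (qPoch z q m * qPoch (-z) q m) =
      (1 - z ^ 2) * (qPoch (q * z) q m * qPoch (-(q * z)) q m) := by
    calc _ = (qPoch z q m * (1 - z * q ^ m)) * (qPoch (-z) q m * (1 + z * q ^ m)) := by ring
      _ = _ := by rw [e1, e2]; ring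
  generalize 1 - z ^ 2 * q ^ (2 * m) = Y at *
  generalize 1 - z ^ 2 = Y' at *
  generalize prefactor z q n r = p
  generalize nodeProd q z m x = N at *
  generalize nodeProd q z 0 x = N' at *
  generalize (-q ^ ((r : ℤ) - (n : ℤ))) ^ m = w
  generalize qPoch z q m = a1 at *
  generalize qPoch (-z) q m = a2 at *
  generalize qPoch (q * z) q m = a3 at *
  generalize qPoch (-(q * z)) q m = a4 at *
  generalize qPoch (q ^ (r + 1) * z ^ 2) q m = a5 at *
  generalize qPoch q q m = a6 at *
  generalize qPoch (z ^ 2) q m = a7 at *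
  generalize qPoch (q ^ (-(r : ℤ))) q m = a8 at *
  generalize (∏ i, qPoch (z * x i) q m) = b1 at *
  generalize (∏ i, qPoch (z / x i) q m) = b2 at *
  generalize (∏ i, qPoch (q * z * x i) q m) = b3 at *
  generalize (∏ i, qPoch (q * z / x i) q m) = b4 at *
  field_simp
  linear_combination (-(p * a7 * a8 * w * b1 * b2 * N)) * e4 - (p * a7 * a8 * w * Y' * a3 * a4) * e3

theorem nodeProd_zero_mul_signSum {q z : K} {n : ℕ} {x : Fin n → K}
    (hx : GenericVars q z x) (r : ℕ) :
    nodeProd q z 0 x * signSum r x z q = ∑ σ, signTerm q z (q ^ r * z) (signPow x σ) := by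
  rw [signSum, Finset.mul_sum]
  refine Finset.sum_congr rfl fun σ _ => ?_
  rw [← mul_assoc, signTerm, nodeProd, ← Finset.prod_mul_distrib]
  congr 1
  refine Finset.prod_congr rfl fun i _ => ?_
  have h0 := hx.ne_zero i
  have h1 : 1 - z * x i ≠ 0 := sub_ne_zero.2 fun e => hx.z_mul_ne_one 0 i (by rw [e]; ring)
  have h2 : 1 - z / x i ≠ 0 := sub_ne_zero.2 fun e => hx.z_ne 0 i (by
    field_simp at e; rw [e]; ring)
  rw [pow_zero, mul_one, signPow]
  have h3 : x i ^ (2 * (σ i : ℤ)) = (x i ^ (σ i : ℤ)) ^ 2 := by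
    rw [mul_comm, zpow_mul]; norm_cast
  rw [h3, zpow_neg]
  have h4 : (1 - z * x i) * (1 - z / x i) =
      (1 - z * (x i ^ (σ i : ℤ))⁻¹) * (1 - z * x i ^ (σ i : ℤ)) := by
    rcases Int.units_eq_one_or (σ i) with e | e <;> rw [e] <;>
      simp only [Units.val_neg, Units.val_one, zpow_neg, zpow_one, inv_inv] <;> ring
  have h5 : 1 - z * (x i ^ (σ i : ℤ))⁻¹ ≠ 0 := fun e => by
    rw [e, zero_mul] at h4
    exact mul_ne_zero h1 h2 h4
  rw [h4]
  generalize 1 - z * (x i ^ (σ i : ℤ))⁻¹ = D at *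
  generalize 1 - z * x i ^ (σ i : ℤ) = E at *
  rw [div_eq_mul_inv (q ^ r * z)]
  field_simp

theorem signSum_eq_sum_of_generic {q z : K} {n : ℕ} {x : Fin n → K} (h : GenericPair q z)
    (hx : GenericVars q z x) (r : ℕ) :
    signSum r x z q = prefactor z q n r * ∑ m ∈ Finset.range (r + 1),
      qHypTerm (upperParams r x z q) (lowerParams r x z q) q (-q ^ ((r : ℤ) - (n : ℤ))) m := by
  have h0 : nodeProd q z 0 x ≠ 0 := by
    refine Finset.prod_ne_zero_iff.2 fun i _ => mul_ne_zero ?_ ?_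
    · exact sub_ne_zero.2 (hx.z_mul_ne_one 0 i).symm
    · have := hx.ne_zero i
      refine sub_ne_zero.2 fun e => hx.z_ne 0 i ?_
      rwa [eq_comm, div_eq_one_iff_eq this] at e
  apply mul_left_cancel₀ h0
  rw [nodeProd_zero_mul_signSum hx, sum_signTerm_eq r h hx, Finset.mul_sum, Finset.mul_sum]
  exact Finset.sum_congr rfl fun m _ => (nodeProd_zero_mul_qHypTerm h hx r m).symm

end Parameters

/-! ### From indeterminates to elements of a field. -/

section Transfer

open MvPolynomial

variable {n : ℕ}

/-- The general-position conditions on indeterminates are checked by separating two polynomials at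
one integer point. -/
theorem algebraMap_ne_of_eval_ne {p p' : MvPolynomial (Fin n ⊕ Fin 2) ℤ} (v : Fin n ⊕ Fin 2 → ℤ)
    (h : eval v p ≠ eval v p') :
    algebraMap _ (FractionRing (MvPolynomial (Fin n ⊕ Fin 2) ℤ)) p ≠ algebraMap _ _ p' :=
  fun e => h (congrArg (eval v) (IsFractionRing.injective _ _ e))

/-- The indeterminates as elements of the field of rational functions: `Sum.inl i` stands for
`x_i`, `Sum.inr 0` for `q` and `Sum.inr 1` for `z`. -/
noncomputable def genericVar (i : Fin n ⊕ Fin 2) :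
    FractionRing (MvPolynomial (Fin n ⊕ Fin 2) ℤ) :=
  algebraMap (MvPolynomial (Fin n ⊕ Fin 2) ℤ) _ (X i)

theorem genericPair_genericVar :
    GenericPair (genericVar (n := n) (Sum.inr 0)) (genericVar (Sum.inr 1)) where
  q_ne_zero := by
    simp [genericVar]
  z_ne_zero := by
    simp [genericVar]
  one_add_ne_zero d := by
    have key : ∀ k : ℕ, 1 + genericVar (n := n) (Sum.inr 0) ^ k ≠ 0 := fun k => by
      have := algebraMap_ne_of_eval_ne (n := n) (p := 1 + X (Sum.inr 0) ^ k) (p' := 0) 1 (by simp)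
      simpa [genericVar] using this
    obtain ⟨k, rfl | rfl⟩ := d.eq_nat_or_neg
    · simpa using key k
    · intro e
      rw [zpow_neg, zpow_natCast] at e
      have h0 : genericVar (n := n) (Sum.inr 0) ^ k ≠ 0 := fun h0 => by simp [h0] at e
      exact key k (by
        linear_combination genericVar (n := n) (Sum.inr 0) ^ k * e - mul_inv_cancel₀ h0)
  q_pow_ne_one k := by
    have := algebraMap_ne_of_eval_ne (n := n) (p := X (Sum.inr 0) ^ (k + 1)) (p' := 1) 0 (by simp)
    simpa [genericVar] using this
  z_sq_mul_ne_one k := by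
    have := algebraMap_ne_of_eval_ne (n := n) (p := X (Sum.inr 1) ^ 2 * X (Sum.inr 0) ^ k)
      (p' := 1) 0 (by simp)
    simpa [genericVar] using this

theorem genericVars_genericVar :
    GenericVars (genericVar (n := n) (Sum.inr 0)) (genericVar (Sum.inr 1))
      (fun i => genericVar (Sum.inl i)) where
  ne_zero i := by
    simp [genericVar]
  sq_ne_one i := by
    have := algebraMap_ne_of_eval_ne (n := n) (p := X (Sum.inl i) ^ 2) (p' := 1) 0 (by simp)
    simpa only [genericVar, map_pow, map_one] using this
  mul_ne_one i j _ := by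
    have := algebraMap_ne_of_eval_ne (n := n) (p := X (Sum.inl i) * X (Sum.inl j)) (p' := 1) 0
      (by simp)
    simpa [genericVar] using this
  ne i j hij := algebraMap_ne_of_eval_ne (Pi.single (Sum.inl i) 1) (by simp [Ne.symm hij])
  z_mul_ne_one k i := by
    have := algebraMap_ne_of_eval_ne (n := n)
      (p := X (Sum.inr 1) * X (Sum.inr 0) ^ k * X (Sum.inl i)) (p' := 1) 0 (by simp)
    simpa [genericVar] using this
  z_ne k i := by
    have := algebraMap_ne_of_eval_ne (n := n)
      (p := X (Sum.inr 1) * X (Sum.inr 0) ^ k) (p' := X (Sum.inl i)) (Sum.elim 1 0) (by simp)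
    simpa [genericVar] using this

variable {A F K : Type*} [CommRing A] [Field F] [Algebra A F] [FaithfulSMul A F] [Field K]

theorem IsSpecialization.signSum {φ : A →+* K} {x' : Fin n → F} {z' q' : F} {x : Fin n → K}
    {z q : K} (r : ℕ) (sx : ∀ i, IsSpecialization φ (x' i) (x i)) (sz : IsSpecialization φ z' z)
    (sq : IsSpecialization φ q' q)
    (hx : ∀ i, x i ≠ 0) (hx_sq : ∀ i, x i ^ 2 ≠ 1) (hx_mul : ∀ i j, i < j → x i * x j ≠ 1)
    (hx_ne : ∀ i j, i < j → x i ≠ x j) (hzx_mul : ∀ i, z * x i ≠ 1) (hzx_ne : ∀ i, z ≠ x i) :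
    IsSpecialization φ (signSum r x' z' q') (signSum r x z q) := by
  refine .sum _ fun σ _ => .mul (.prod _ fun i _ => ?_) (.prod _ fun i _ => .prod _ fun j hj => ?_)
  · refine .mul (.div (.sub .one (sq.mul ((sx i).zpow (hx i) _)))
      (.sub .one ((sx i).zpow (hx i) _)) ?_) (.div (.sub .one (((sq.pow r).mul sz).mul
      ((sx i).zpow (hx i) _))) (.sub .one (sz.mul ((sx i).zpow (hx i) _))) ?_)
    · rw [mul_comm, zpow_mul, sub_ne_zero, ne_comm]
      have : x i ^ (2 : ℤ) ≠ 1 := by exact_mod_cast hx_sq i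
      rcases Int.units_eq_one_or (σ i) with e | e <;> rw [e]
      · simpa only [Units.val_one, zpow_one] using this
      · simpa only [Units.val_neg, Units.val_one, zpow_neg, zpow_one, inv_zpow, inv_eq_one,
          ne_eq] using this
    · rw [sub_ne_zero, ne_comm]
      rcases Int.units_eq_one_or (σ i) with e | e
      · simpa [e, mul_inv_eq_one₀ (hx i)] using hzx_ne i
      · simpa [e] using hzx_mul i
  · refine .div (.sub .one ((sq.mul ((sx i).zpow (hx i) _)).mul ((sx j).zpow (hx j) _)))
      (.sub .one (((sx i).zpow (hx i) _).mul ((sx j).zpow (hx j) _))) ?_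
    have hij := Finset.mem_Ioi.1 hj
    rw [sub_ne_zero, ne_comm]
    rcases Int.units_eq_one_or (σ i) with e | e <;> rcases Int.units_eq_one_or (σ j) with e' | e'
    · simpa [e, e'] using hx_mul i j hij
    · simpa [e, e', mul_inv_eq_one₀ (hx j)] using hx_ne i j hij
    · simpa [e, e', inv_mul_eq_one₀ (hx i)] using hx_ne i j hij
    · rw [e, e']
      simp only [Units.val_neg, Units.val_one, zpow_neg, zpow_one, ← mul_inv, ne_eq, inv_eq_one]
      exact hx_mul i j hij

theorem IsSpecialization.qHypTerm {φ : A →+* K} {x' : Fin n → F} {z' q' w' : F} {x : Fin n → K}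
    {z q w : K} {r m : ℕ} (sx : ∀ i, IsSpecialization φ (x' i) (x i))
    (sz : IsSpecialization φ z' z) (sq : IsSpecialization φ q' q) (sw : IsSpecialization φ w' w)
    (hq : q ≠ 0) (hx : ∀ i, x i ≠ 0) (hm : m ≤ r) (hqq : _root_.qPoch q q r ≠ 0)
    (hlow : ∀ i, _root_.qPoch (lowerParams r x z q i) q r ≠ 0) :
    IsSpecialization φ (qHypTerm (upperParams r x' z' q') (lowerParams r x' z' q') q' w' m)
      (qHypTerm (upperParams r x z q) (lowerParams r x z q) q w m) := by
  have hlow' : ∏ i, _root_.qPoch (lowerParams r x z q i) q m ≠ 0 :=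
    Finset.prod_ne_zero_iff.2 fun i _ => qPoch_ne_zero_of_le hm (hlow i)
  rw [_root_.qHypTerm, _root_.qHypTerm]
  refine .mul (.div ?_ ?_ hlow') (.div (sw.pow m) (sq.qPoch sq m) (qPoch_ne_zero_of_le hm hqq))
  · rw [prod_upperParams _ _ _ _ (fun a => _root_.qPoch a q' m),
      prod_upperParams _ _ _ _ (fun a => _root_.qPoch a q m)]
    exact .mul (.qPoch (sz.pow 2) sq m) <| .mul (.qPoch (sq.mul sz) sq m) <|
      .mul (.qPoch (sq.mul sz).neg sq m) <| .mul (.qPoch (sq.zpow hq _) sq m) <|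
      .mul (.prod _ fun i _ => .qPoch ((sq.mul sz).mul (sx i)) sq m)
        (.prod _ fun i _ => .qPoch ((sq.mul sz).div (sx i) (hx i)) sq m)
  · rw [prod_lowerParams _ _ _ _ (fun a => _root_.qPoch a q' m),
      prod_lowerParams _ _ _ _ (fun a => _root_.qPoch a q m)]
    exact .mul (.qPoch sz sq m) <| .mul (.qPoch sz.neg sq m) <|
      .mul (.qPoch ((sq.pow _).mul (sz.pow 2)) sq m) <|
      .mul (.prod _ fun i _ => .qPoch (sz.div (sx i) (hx i)) sq m)
        (.prod _ fun i _ => .qPoch (sz.mul (sx i)) sq m)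

/-- Only `r > n` puts a shifted factorial with base `-q` in a denominator; its factors are `1 +
q^(-k)` with `0 ≤ k < r - n`, which is what `hneg` controls. -/
theorem IsSpecialization.prefactor {φ : A →+* K} {z' q' : F} {z q : K} {r : ℕ}
    (sz : IsSpecialization φ z' z) (sq : IsSpecialization φ q' q) (hq : q ≠ 0)
    (hneg : ∀ k : ℕ, n + k < r → 1 + q ^ k ≠ 0) (hpre : _root_.qPoch (q * z ^ 2) q r ≠ 0) :
    IsSpecialization φ (prefactor z' q' n r) (prefactor z q n r) := by
  refine .mul (.mul (sq.zpow hq _) ?_) (.div (.qPoch (sq.mul (sz.pow 2)) (sq.pow 2) r)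
    (.qPoch (sq.mul (sz.pow 2)) sq r) hpre)
  rcases hd : (n : ℤ) - r with k | k
  · exact .qPoch sq.neg sq k
  · refine .inv (.qPoch (sq.neg.mul (sq.zpow hq _)) sq _) (qPoch_ne_zero fun i hi e => ?_)
    rw [Int.negSucc_eq] at hd
    have hki : i + (k - i) = k := by omega
    refine hneg (k - i) (by omega) ?_
    have h1 : -q * q ^ (-((k : ℤ) + 1)) * q ^ i * q ^ (k - i) = -1 := by
      rw [mul_assoc, ← pow_add, hki, mul_assoc, ← zpow_natCast, ← zpow_add₀ hq,
        show -((k : ℤ) + 1) + k = -1 by ring, zpow_neg_one, neg_mul, mul_inv_cancel₀ hq]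
    rw [e] at h1
    linear_combination h1

end Transfer

/-- Both sides of the generic identity specialize to the two sides here, and values are unique. The
general-position hypotheses thus disappear: `z = 0`, characteristic two or a root of unity `q` are
allowed whenever the listed denominators are nonzero. -/
theorem signSum_eq_sum {K : Type*} [Field K] {n r : ℕ} {x : Fin n → K} {z q : K}
    (hq : q ≠ 0) (hx : ∀ i, x i ≠ 0)
    (hx_sq : ∀ i, x i ^ 2 ≠ 1)
    (hx_mul : ∀ i j, i < j → x i * x j ≠ 1)
    (hx_ne : ∀ i j, i < j → x i ≠ x j)
    (hzx_mul : ∀ i, z * x i ≠ 1)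
    (hzx_ne : ∀ i, z ≠ x i)
    (hneg : ∀ k : ℕ, n + k < r → 1 + q ^ k ≠ 0)
    (hpre : qPoch (q * z ^ 2) q r ≠ 0)
    (hqq : qPoch q q r ≠ 0)
    (hlow : ∀ i, qPoch (lowerParams r x z q i) q r ≠ 0) :
    signSum r x z q = prefactor z q n r * ∑ m ∈ Finset.range (r + 1),
      qHypTerm (upperParams r x z q) (lowerParams r x z q) q (-q ^ ((r : ℤ) - (n : ℤ))) m := by
  let φ : MvPolynomial (Fin n ⊕ Fin 2) ℤ →+* K :=
    MvPolynomial.eval₂Hom (Int.castRingHom K) (Sum.elim x ![q, z])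
  have sp : ∀ i, IsSpecialization φ (genericVar i) (Sum.elim x ![q, z] i) := fun i => by
    have := IsSpecialization.of_algebraMap (F := FractionRing (MvPolynomial (Fin n ⊕ Fin 2) ℤ)) φ
      (MvPolynomial.X i)
    rwa [MvPolynomial.eval₂Hom_X'] at this
  have sx : ∀ i, IsSpecialization φ (genericVar (Sum.inl i)) (x i) := fun i => sp (Sum.inl i)
  have sq : IsSpecialization φ (genericVar (Sum.inr 0)) q := sp (Sum.inr 0)
  have sz : IsSpecialization φ (genericVar (Sum.inr 1)) z := sp (Sum.inr 1)
  have hl := IsSpecialization.signSum r sx sz sq hx hx_sq hx_mul hx_ne hzx_mul hzx_ne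
  rw [signSum_eq_sum_of_generic genericPair_genericVar genericVars_genericVar] at hl
  refine hl.unique (.mul (.prefactor sz sq hq hneg hpre) (.sum _ fun m hm => ?_))
  exact .qHypTerm sx sz sq (sq.zpow hq _).neg hq hx
    (Nat.lt_succ_iff.1 (Finset.mem_range.1 hm)) hqq hlow

/-- The hypotheses say that `q` and the `x_i` are invertible and that none of the denominators
in the identity vanishes: first those of the sum over signs, then those of the prefactor, then
those of the terms `0, …, r` of the terminating series. -/
theorem theorem8 {K : Type*} [Field K] [TopologicalSpace K] (n r : ℕ) (x : Fin n → K) (z q : K)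
    (hq : q ≠ 0) (hx : ∀ i, x i ≠ 0)
    (hx_sq : ∀ i, x i ^ 2 ≠ 1)
    (hx_mul : ∀ i j, i < j → x i * x j ≠ 1)
    (hx_ne : ∀ i j, i < j → x i ≠ x j)
    (hzx_mul : ∀ i, z * x i ≠ 1)
    (hzx_ne : ∀ i, z ≠ x i)
    (hneg : ∀ k : ℕ, n + k < r → 1 + q ^ k ≠ 0)
    (hpre : qPoch (q * z ^ 2) q r ≠ 0)
    (hqq : qPoch q q r ≠ 0)
    (hlow : ∀ i, qPoch (lowerParams r x z q i) q r ≠ 0) :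
    IsVeryWellPoised (upperParams r x z q) (lowerParams r x z q) q ∧
    (∀ m : ℕ, r < m →
      qHypTerm (upperParams r x z q) (lowerParams r x z q) q (-q ^ ((r : ℤ) - (n : ℤ))) m = 0) ∧
    signSum r x z q =
      q ^ ((n : ℤ) * (r : ℤ) - (r.choose 2 : ℤ)) * qPochInt (-q) q ((n : ℤ) - (r : ℤ)) *
        (qPoch (q * z ^ 2) (q ^ 2) r / qPoch (q * z ^ 2) q r) *
        qHyp (upperParams r x z q) (lowerParams r x z q) q (-q ^ ((r : ℤ) - (n : ℤ))) := by

  have hzero : ∀ m : ℕ, r < m →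
      qHypTerm (upperParams r x z q) (lowerParams r x z q) q (-q ^ ((r : ℤ) - (n : ℤ))) m = 0 :=
    fun m hm => qHypTerm_params_eq_zero x z _ hq hm
  refine ⟨isVeryWellPoised_params r hq hx, hzero, ?_⟩
  rw [signSum_eq_sum hq hx hx_sq hx_mul hx_ne hzx_mul hzx_ne hneg hpre hqq hlow, qHyp,
    tsum_eq_sum (s := Finset.range (r + 1)) fun m hm => hzero m (by simpa using hm)]
  rfl
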